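/- Let $n,k\ge 0$ be integers and let $V_n$ be a complex vector space with basis $v_1,\dots,v_n$, on which the symmetric group $\mathfrak S_n$ acts by $\sigma v_i=v_{\sigma(i)}$. Let $\mathfrak S_n$ act diagonally on $V_n^{\otimes k}$, and let $S^kV_n=(V_n^{\otimes k})e_k$ be the symmetric power, with the restricted $\mathfrak S_n$-action, where $e_k=\frac1{k!}\sum_{\tau\in\mathfrak S_k}\tau$ acts by place permutation, $(x_1\otimes\cdots\otimes x_k)\tau=x_{\tau(1)}\otimes\cdots\otimes x_{\tau(k)}$. For a partition $\mu$ of $n$, let $M(\mu)$ be the permutation module, that is, the complex vector space with basis the $\mu$-tabloids (the $\mu$-tableaux, i.e. bijective fillings of the boxes of $\mu$ with $1,\dots,n$, up to permutation of the entries within rows), with $\mathfrak S_n$ acting on the entries. Let $S(\mu)\subseteq M(\mu)$ be the Specht module, the span of the polytabloids $\sum_{\pi}\operatorname{sgn}(\pi)\{\pi t\}$, where $t$ is a $\mu$-tableau, $\{\pi t\}$ is the tabloid of $\pi t$, and $\pi$ runs over the column stabilizer of $t$. For partitions $\lambda,\mu$ of $n$, let the Kostka number $K_{\lambda,\mu}$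 be the number of semistandard $\lambda$-tableaux of type $\mu$: fillings of the boxes of $\lambda$ in which the number $i$ occurs $\mu_i$ times, weakly increasing along rows and strictly increasing down columns. Let $\mathrm{Par}_k^{\le n}$ be the set of partitions of $k$ with at most $n$ parts (the only partition of $0$ is the empty one). For $\nu\in\mathrm{Par}_k^{\le n}$ let $a_1,\dots,a_p$ be the multiplicities of the distinct parts of $\nu$, put $d=n-(a_1+\cdots+a_p)=n-\ell(\nu)$, and let $\Phi(\nu)$ be the partition of $n$ obtained by arranging $a_1,\dots,a_p,d$ in weakly decreasing order, with $d$ omitted if $d=0$. **a)** There is an isomorphism of $\mathbb C\mathfrak S_n$-modules $$S^kV_n\;\cong\;\bigoplus_{\nu\in\mathrm{Par}_k^{\le n}}M(\Phi(\nu)).$$ **b)** For every partition $\lambda$ of $n$, the multiplicity $[S^kV_n:S(\lambda)]$ of $S(\lambda)$ in $S^kV_n$, that is, the number of summands isomorphic to $S(\lambda)$ in any decomposition of $S^kV_n$ into a direct sum of irreducible submodules (such decompositions exist), is $$[S^kV_n:S(\lambda)]=\sum_{\nu\in\mathrm{Par}_k^{\le n}}K_{\lambda,\Phi(\nu)}.$$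 -/

import Mathlib

open scoped TensorProduct

noncomputable section

namespace SymPow

/-! ### The symmetric power as a representation of the symmetric group -/

section SymmetricPower

variable {n : ℕ} {V : Type*} [AddCommGroup V] [Module ℂ V]

/-- The natural representation of the symmetric group `𝔖ₙ` on a complex vector space with basis
`v₁, …, vₙ`, given by `σ vᵢ = v_{σ(i)}`. -/
def natRep (v : Module.Basis (Fin n) ℂ V) : Representation ℂ (Equiv.Perm (Fin n)) V where
  toFun σ := (v.equiv v σ).toLinearMap
  map_one' := v.ext fun i => by simp
  map_mul' σ τ := v.ext fun i => by simp

/-- The diagonal action of a group on the `k`-th tensor power of a representation. -/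
def tensorPowRep {G : Type*} [Group G] (ρ : Representation ℂ G V) (k : ℕ) :
    Representation ℂ G (⨂[ℂ] _ : Fin k, V) where
  toFun g := PiTensorProduct.map fun _ => ρ g
  map_one' := by
    ext x
    simp
  map_mul' g h := by
    ext x
    simp

/-- The right place permutation action `(x₁ ⊗ ⋯ ⊗ xₖ)τ = x_{τ(1)} ⊗ ⋯ ⊗ x_{τ(k)}`. -/
def placePerm (V : Type*) [AddCommGroup V] [Module ℂ V] {k : ℕ} (τ : Equiv.Perm (Fin k)) :
    (⨂[ℂ] _ : Fin k, V) →ₗ[ℂ] (⨂[ℂ] _ : Fin k, V) :=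
  (PiTensorProduct.reindex ℂ (fun _ : Fin k => V) τ.symm).toLinearMap

theorem placePerm_tprod {k : ℕ} (τ : Equiv.Perm (Fin k)) (x : Fin k → V) :
    placePerm V τ (PiTensorProduct.tprod ℂ x) = PiTensorProduct.tprod ℂ fun j => x (τ j) :=
  PiTensorProduct.reindex_tprod τ.symm x

/-- The right action on the `k`-th tensor power of the symmetrizing idempotent
`eₖ = (1 / k!) ∑_{τ ∈ 𝔖ₖ} τ`. -/
def symmetrizer (V : Type*) [AddCommGroup V] [Module ℂ V] (k : ℕ) :
    (⨂[ℂ] _ : Fin k, V) →ₗ[ℂ] (⨂[ℂ] _ : Fin k, V) :=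
  (k.factorial : ℂ)⁻¹ • ∑ τ : Equiv.Perm (Fin k), placePerm V τ

theorem tensorPowRep_placePerm {G : Type*} [Group G] (ρ : Representation ℂ G V) {k : ℕ} (g : G)
    (τ : Equiv.Perm (Fin k)) (x : ⨂[ℂ] _ : Fin k, V) :
    tensorPowRep ρ k g (placePerm V τ x) = placePerm V τ (tensorPowRep ρ k g x) := by
  have : tensorPowRep ρ k g ∘ₗ placePerm V τ = placePerm V τ ∘ₗ tensorPowRep ρ k g := by
    ext x
    simp [tensorPowRep, placePerm_tprod]
  exact LinearMap.congr_fun this x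

theorem tensorPowRep_symmetrizer {G : Type*} [Group G] (ρ : Representation ℂ G V) {k : ℕ} (g : G)
    (x : ⨂[ℂ] _ : Fin k, V) :
    tensorPowRep ρ k g (symmetrizer V k x) = symmetrizer V k (tensorPowRep ρ k g x) := by
  simp [symmetrizer, tensorPowRep_placePerm]

/-- `Sᵏ V = V^{⊗ k} eₖ`, as a subrepresentation of `V^{⊗ k}`. -/
def symPowSub {G : Type*} [Group G] (ρ : Representation ℂ G V) (k : ℕ) :
    Subrepresentation (tensorPowRep ρ k) where
  toSubmodule := LinearMap.range (symmetrizer V k)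
  apply_mem_toSubmodule g w := by
    rintro ⟨x, rfl⟩
    exact ⟨tensorPowRep ρ k g x, (tensorPowRep_symmetrizer ρ g x).symm⟩

/-- The `𝔖ₙ`-representation `Sᵏ Vₙ`, where `Vₙ` has basis `v₁, …, vₙ`. -/
def symPowRep (v : Module.Basis (Fin n) ℂ V) (k : ℕ) :
    Representation ℂ (Equiv.Perm (Fin n)) (symPowSub (natRep v) k).toSubmodule :=
  (symPowSub (natRep v) k).toRepresentation

end SymmetricPower

/-! ### Tableaux, tabloids, permutation modules and Specht modules -/

section Tableaux

variable {n : ℕ}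

/-- The parts of a partition, listed in weakly decreasing order. -/
def partList (lam : n.Partition) : List ℕ := lam.parts.sort (· ≥ ·)

theorem partList_sorted (lam : n.Partition) : (partList lam).SortedGE :=
  (Multiset.pairwise_sort _ _).sortedGE

/-- The Young diagram of a partition `(λ₁ ≥ λ₂ ≥ ⋯)`: row `i` has `λᵢ` boxes. Rows and columns are
numbered from `0`. -/
def diagram (lam : n.Partition) : YoungDiagram :=
  YoungDiagram.ofRowLens (partList lam) (partList_sorted lam)

/-- `λ`-tableaux: fillings of the boxes of `λ` with the `n` elements of `Fin n`, each occurring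
exactly once. -/
abbrev Tableau (lam : n.Partition) : Type := {c : ℕ × ℕ // c ∈ (diagram lam).cells} ≃ Fin n

variable {lam : n.Partition}

/-- The row of the tableau `t` that contains the entry `x`. -/
def rowOf (t : Tableau lam) (x : Fin n) : ℕ := (t.symm x).1.1

/-- The column of the tableau `t` that contains the entry `x`. -/
def colOf (t : Tableau lam) (x : Fin n) : ℕ := (t.symm x).1.2

/-- `𝔖ₙ` acts on tableaux by acting on the entries. -/
def actTableau (σ : Equiv.Perm (Fin n)) (t : Tableau lam) : Tableau lam := t.trans σ

theorem rowOf_act (σ : Equiv.Perm (Fin n)) (t : Tableau lam) (x : Fin n) :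
    rowOf (actTableau σ t) x = rowOf t (σ⁻¹ x) := rfl

theorem colOf_act (σ : Equiv.Perm (Fin n)) (t : Tableau lam) (x : Fin n) :
    colOf (actTableau σ t) x = colOf t (σ⁻¹ x) := rfl

/-- Two tableaux are row equivalent if they differ by permuting the entries within the rows, that
is, if each number lies in the same row of both. -/
def rowSetoid (lam : n.Partition) : Setoid (Tableau lam) where
  r s t := ∀ x, rowOf s x = rowOf t x
  iseqv := ⟨fun _ _ => rfl, fun h x => (h x).symm, fun h h' x => (h x).trans (h' x)⟩

/-- `λ`-tabloids: row equivalence classes of `λ`-tableaux. -/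
def Tabloid (lam : n.Partition) : Type := Quotient (rowSetoid lam)

/-- The tabloid `{t}` of a tableau `t`. -/
def toTabloid (t : Tableau lam) : Tabloid lam := Quotient.mk (rowSetoid lam) t

/-- The induced action of `𝔖ₙ` on tabloids: `σ {t} = {σ t}`. -/
instance : MulAction (Equiv.Perm (Fin n)) (Tabloid lam) where
  smul σ := Quotient.map (actTableau σ) fun s t (h : ∀ x, rowOf s x = rowOf t x) x => by
    simp only [rowOf_act, h]
  one_smul T := Quotient.inductionOn T fun _ => rfl
  mul_smul _ _ T := Quotient.inductionOn T fun _ => rfl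

theorem smul_toTabloid (σ : Equiv.Perm (Fin n)) (t : Tableau lam) :
    σ • toTabloid t = toTabloid (actTableau σ t) := rfl

/-- The permutation module `M(λ)`: the free complex vector space on the set of `λ`-tabloids, with
`𝔖ₙ` permuting the basis. -/
def permModule (lam : n.Partition) :
    Representation ℂ (Equiv.Perm (Fin n)) (MonoidAlgebra ℂ (Tabloid lam)) :=
  Representation.ofMulAction ℂ (Equiv.Perm (Fin n)) (Tabloid lam)

/-- The column stabilizer of a tableau `t`: the permutations preserving the set of entries of each
column of `t`. -/
def colStab (t : Tableau lam) : Finset (Equiv.Perm (Fin n)) :=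
  {π | ∀ x, colOf t (π x) = colOf t x}

theorem mem_colStab {t : Tableau lam} {π : Equiv.Perm (Fin n)} :
    π ∈ colStab t ↔ ∀ x, colOf t (π x) = colOf t x := by
  simp [colStab]

/-- The polytabloid `e_t = ∑ sgn(π) {π t}`, the sum being over the column stabilizer of `t`. -/
def polytabloid (t : Tableau lam) : MonoidAlgebra ℂ (Tabloid lam) :=
  ∑ π ∈ colStab t, MonoidAlgebra.single (toTabloid (actTableau π t)) ((Equiv.Perm.sign π : ℤ) : ℂ)

theorem permModule_polytabloid (σ : Equiv.Perm (Fin n)) (t : Tableau lam) :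
    permModule lam σ (polytabloid t) = polytabloid (actTableau σ t) := by
  simp only [polytabloid, map_sum, permModule, Representation.ofMulAction_single, smul_toTabloid]
  refine Finset.sum_bij' (fun π _ => σ * π * σ⁻¹) (fun π _ => σ⁻¹ * π * σ) ?_ ?_ ?_ ?_ ?_
  · intro π hπ
    simp only [mem_colStab, colOf_act] at hπ ⊢
    intro x
    simpa using hπ (σ⁻¹ x)
  · intro π hπ
    simp only [mem_colStab, colOf_act] at hπ ⊢
    intro x
    simpa using hπ (σ x)
  · intro π _
    group
  · intro π _
    group
  · intro π _
    congr 1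
    · congr 1
      ext c
      simp [actTableau]
    · have h : Equiv.Perm.sign (σ * π * σ⁻¹) = Equiv.Perm.sign π := by
        rw [map_mul, map_mul, map_inv, mul_comm, inv_mul_cancel_left]
      rw [h]

/-- The Specht module `S(λ)`: the subrepresentation of `M(λ)` spanned by the polytabloids. -/
def spechtSub (lam : n.Partition) : Subrepresentation (permModule lam) where
  toSubmodule := Submodule.span ℂ (Set.range (polytabloid (lam := lam)))
  apply_mem_toSubmodule σ w hw := by
    induction hw using Submodule.span_induction with
    | mem w hw =>
      obtain ⟨t, rfl⟩ := hw
      rw [permModule_polytabloid]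
      exact Submodule.subset_span ⟨_, rfl⟩
    | zero => simp
    | add x y _ _ hx hy => rw [map_add]; exact Submodule.add_mem _ hx hy
    | smul a x _ hx => rw [map_smul]; exact Submodule.smul_mem _ a hx

/-- The Specht module `S(λ)` as a representation of `𝔖ₙ`. -/
def specht (lam : n.Partition) :
    Representation ℂ (Equiv.Perm (Fin n)) (spechtSub lam).toSubmodule :=
  (spechtSub lam).toRepresentation

/-- Semistandard `λ`-tableaux of type `μ`. The entries are numbered from `0`, so the entry `i` has to
occur `μᵢ₊₁` times, where `μ₁ ≥ μ₂ ≥ ⋯` are the parts of `μ`, followed by zeros. -/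
def SStd (lam mu : n.Partition) : Type :=
  {T : SemistandardYoungTableau (diagram lam) //
    ∀ i : ℕ, ((diagram lam).cells.filter fun c => T c.1 c.2 = i).card = (partList mu).getD i 0}

/-- The Kostka number `K_{λμ}`. -/
def kostka (lam mu : n.Partition) : ℕ := Nat.card (SStd lam mu)

end Tableaux

/-! ### Partitions of bounded length and the multiplicity function -/

/-- The partitions of `k` with at most `n` parts. -/
abbrev ParLE (k n : ℕ) : Type := {nu : k.Partition // nu.parts.card ≤ n}

/-- The partition `Φ(ν) = ord(a₁, …, aₚ, d)` of `n`, where `a₁, …, aₚ` are the multiplicities of the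
distinct parts of `ν` and `d = n - (a₁ + ⋯ + aₚ)`, which is left out if it is zero. -/
def Phi {k n : ℕ} (nu : ParLE k n) : n.Partition :=
  Nat.Partition.ofSums n
    ((n - nu.1.parts.card) ::ₘ nu.1.parts.dedup.map fun a => nu.1.parts.count a) (by
      have h : (nu.1.parts.dedup.map fun a => nu.1.parts.count a).sum = nu.1.parts.card :=
        Multiset.toFinset_sum_count_eq nu.1.parts
      rw [Multiset.sum_cons, h]
      exact Nat.sub_add_cancel nu.2)

/-! ### Multiplicities -/

/-- A decomposition of a representation into an internal direct sum of finitely many irreducible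
subrepresentations. -/
structure IrredDecomp {G : Type*} [Group G] {W : Type*} [AddCommGroup W] [Module ℂ W]
    (ρ : Representation ℂ G W) where
  /-- The number of summands. -/
  len : ℕ
  /-- The summands. -/
  sub : Fin len → Subrepresentation ρ
  irreducible : ∀ i, (sub i).toRepresentation.IsIrreducible
  isInternal : DirectSum.IsInternal fun i => (sub i).toSubmodule

/-- `[ρ : σ] = m`: the representation `ρ` is a finite direct sum of irreducible subrepresentations,
and in every such decomposition exactly `m` of the summands are isomorphic to `σ`. -/
def HasMultiplicity {G : Type*} [Group G] {W : Type*} [AddCommGroup W] [Module ℂ W]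
    {U : Type*} [AddCommGroup U] [Module ℂ U]
    (ρ : Representation ℂ G W) (σ : Representation ℂ G U) (m : ℕ) : Prop :=
  Nonempty (IrredDecomp ρ) ∧ ∀ D : IrredDecomp ρ,
    Nat.card {i : Fin D.len // Nonempty ((D.sub i).toRepresentation.Equiv σ)} = m

end SymPow

end

/-!
The symmetric power `Sᵏ Vₙ` has a basis of monomials `v₁^{m₁} ⋯ vₙ^{mₙ}` of degree `k`, which the
symmetric group permutes. The orbit of a monomial is determined by the partition `ν` of `k` formed
by its nonzero exponents, and a monomial in this orbit amounts to the ordered set partition of the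
variables according to their exponents, that is, to a tabloid of shape `Φ(ν)`
(`exists_sigma_tabloid_equiv`). This gives the isomorphism `Sᵏ Vₙ ≅ ⨁ M(Φ(ν))`
(`nonempty_symPowRep_equiv`).

For the multiplicities it suffices, by Maschke's theorem and Schur's lemma
(`hasMultiplicity_finrank`), that `S(λ)` is irreducible and that `dim Hom(S(λ), M(μ)) = K_{λμ}`
(Young's rule, `finrank_hom_specht_permModule`). Fix a `λ`-tableau `t`. A `μ`-tabloid is recorded by
its word, which sends each entry to its row, and through `t` a word is a filling of the diagram of
`λ`; semistandard words thus correspond to semistandard `λ`-tableaux of type `μ`. A homomorphism `θ`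
is determined by the coefficients of `θ(e_t)`.

* These coefficients are antisymmetric under column permutations and satisfy the Garnir relations.
  If they are not all zero, take a word in the support whose column weight `∑ (column) * (letter)`,
  and then whose row weight, is largest. Were its columns not strictly increasing, a transposition
  would produce a larger word or a vanishing coefficient; were a row to decrease between two
  adjacent boxes, the terms of the corresponding Garnir relation that come from column permutations
  would all agree, and the others would have larger column weight and so vanish, which makes the
  coefficient itself vanish. So this word is semistandard
  (`exists_isSemistandard_of_ne_zero`), and `θ` is determined by its coefficients at semistandard
  words.
* Conversely each semistandard word gives a homomorphism by summing over row permutations, and by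
  the rearrangement inequality the matrix of its coefficients at semistandard words is triangular
  with respect to the column weight, with nonzero diagonal (`linearIndependent_orbitHom`).

For `μ = λ` there is at most one semistandard word, since the letter of a box is at least its row
while both have the same sum. Hence all homomorphisms `S(λ) → M(λ)` are multiples of the inclusion,
and `S(λ)` is irreducible (`isIrreducible_specht`).
-/

namespace SymPow

/-! ### Multiplicities and spaces of intertwining maps -/

section Multiplicity

open Representation

variable {G : Type*} [Group G] {W W' U : Type*} [AddCommGroup W] [Module ℂ W]
  [AddCommGroup W'] [Module ℂ W'] [AddCommGroup U] [Module ℂ U]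

/-- Composition with an isomorphism identifies the spaces of intertwining maps. -/
def homCongr (σ : Representation ℂ G U) {ρ : Representation ℂ G W} {ρ' : Representation ℂ G W'}
    (e : ρ.Equiv ρ') : IntertwiningMap σ ρ ≃ₗ[ℂ] IntertwiningMap σ ρ' where
  toFun f := e.toIntertwiningMap.comp f
  invFun f := e.symm.toIntertwiningMap.comp f
  map_add' f g := by
    ext x
    exact map_add e.toIntertwiningMap (f x) (g x)
  map_smul' a f := by
    ext x
    exact map_smul e.toIntertwiningMap a (f x)
  left_inv f := by
    ext x
    exact e.symm_apply_apply (f x)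
  right_inv f := by
    ext x
    exact e.apply_symm_apply (f x)

/-- Intertwining maps into a finite direct sum are families of intertwining maps into the
summands. -/
noncomputable def homDirectSum {ι : Type*} [Fintype ι] [DecidableEq ι] {M : ι → Type*}
    [∀ i, AddCommGroup (M i)] [∀ i, Module ℂ (M i)] (σ : Representation ℂ G U)
    (ρ : ∀ i, Representation ℂ G (M i)) :
    IntertwiningMap σ (directSum ρ) ≃ₗ[ℂ] ∀ i, IntertwiningMap σ (ρ i) where
  toFun f i := LinearMap.intertwiningMap_of_isIntertwiningMap σ (ρ i)
    (DirectSum.component ℂ ι M i ∘ₗ f.toLinearMap) fun g u => by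
      simp only [LinearMap.comp_apply, IntertwiningMap.toLinearMap_apply, f.isIntertwining]
      rfl
  invFun f := LinearMap.intertwiningMap_of_isIntertwiningMap σ (directSum ρ)
    (∑ i, DirectSum.lof ℂ ι M i ∘ₗ (f i).toLinearMap) fun g u => by
      simp [(f _).isIntertwining, map_sum, LinearMap.sum_apply]
  map_add' f g := by
    ext i u
    simp
  map_smul' a f := by
    ext i u
    simp
  left_inv f := by
    ext u : 2
    simp only [LinearMap.toIntertwiningMap, IntertwiningMap.toLinearMap_apply]
    refine DFinsupp.ext fun j => ?_
    simp only [LinearMap.sum_apply, LinearMap.comp_apply, IntertwiningMap.toLinearMap_apply,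
      LinearMap.toIntertwiningMap]
    rw [DFinsupp.finsetSum_apply, Finset.sum_eq_single j]
    · exact DirectSum.component.lof_self ℂ j _
    · intro i _ hij
      exact (DirectSum.component.of ℂ j i _).trans (dif_neg hij)
    · simp
  right_inv f := by
    ext j u
    simp only [LinearMap.toIntertwiningMap, IntertwiningMap.toLinearMap_apply,
      LinearMap.sum_apply, LinearMap.comp_apply, map_sum]
    rw [Finset.sum_eq_single j]
    · exact DirectSum.component.lof_self ℂ j _
    · intro i _ hij
      exact (DirectSum.component.of ℂ j i _).trans (dif_neg hij)
    · simp

theorem finrank_hom_directSum {ι : Type*} [Fintype ι] {M : ι → Type*}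
    [∀ i, AddCommGroup (M i)] [∀ i, Module ℂ (M i)] [FiniteDimensional ℂ U]
    [∀ i, FiniteDimensional ℂ (M i)] (σ : Representation ℂ G U)
    (ρ : ∀ i, Representation ℂ G (M i)) :
    Module.finrank ℂ (IntertwiningMap σ (directSum ρ)) =
      ∑ i, Module.finrank ℂ (IntertwiningMap σ (ρ i)) := by
  classical
  rw [(homDirectSum σ ρ).finrank_eq, Module.finrank_pi_fintype]

/-- A representation is isomorphic to the direct sum of the terms of an internal decomposition. -/
noncomputable def IrredDecomp.equiv {ρ : Representation ℂ G W} (D : IrredDecomp ρ) :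
    (directSum fun i => (D.sub i).toRepresentation).Equiv ρ :=
  Representation.Equiv.mk
    (LinearEquiv.ofBijective (DirectSum.coeLinearMap fun i => (D.sub i).toSubmodule)
      D.isInternal) fun g => by
    ext i x
    change DirectSum.coeLinearMap (fun i => (D.sub i).toSubmodule)
        (DirectSum.lmap _ (DirectSum.lof ℂ _ (fun i => (D.sub i).toSubmodule) i x)) =
      ρ g (DirectSum.coeLinearMap (fun i => (D.sub i).toSubmodule)
        (DirectSum.lof ℂ _ (fun i => (D.sub i).toSubmodule) i x))
    rw [DirectSum.lmap_lof, DirectSum.coeLinearMap_lof, DirectSum.coeLinearMap_lof]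
    rfl

open Classical in
/-- By Schur's lemma a finite-dimensional irreducible `σ` occurs `dim Hom(σ, ρ)` times in any
decomposition of `ρ` into irreducibles. -/
theorem card_equiv_eq_finrank [FiniteDimensional ℂ W] [FiniteDimensional ℂ U]
    {ρ : Representation ℂ G W} (D : IrredDecomp ρ) (σ : Representation ℂ G U) [σ.IsIrreducible] :
    Nat.card {i : Fin D.len // Nonempty ((D.sub i).toRepresentation.Equiv σ)} =
      Module.finrank ℂ (IntertwiningMap σ ρ) := by
  rw [← (homCongr σ D.equiv).finrank_eq, finrank_hom_directSum, Nat.card_eq_fintype_card,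
    Fintype.card_subtype, Finset.card_filter]
  refine Finset.sum_congr rfl fun i _ => ?_
  have := D.irreducible i
  split_ifs with h
  · obtain ⟨e⟩ := h
    rw [(homCongr σ e).finrank_eq, IsIrreducible.finrank_intertwiningMap_self]
  · have : IsEmpty (σ.Equiv (D.sub i).toRepresentation) := ⟨fun e => h ⟨e.symm⟩⟩
    exact Module.finrank_zero_of_subsingleton.symm

/-- An atom of the lattice of subrepresentations is irreducible. -/
theorem isIrreducible_of_isAtom {ρ : Representation ℂ G W} {N : Subrepresentation ρ}
    (hN : IsAtom N) : N.toRepresentation.IsIrreducible := by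
  have key : ∀ M : Subrepresentation N.toRepresentation, M = ⊥ ∨ M = ⊤ := by
    intro M
    let M' : Subrepresentation ρ :=
      { toSubmodule := M.toSubmodule.map N.toSubmodule.subtype
        apply_mem_toSubmodule := by
          rintro g _ ⟨x, hx, rfl⟩
          exact ⟨_, M.apply_mem_toSubmodule g hx, rfl⟩ }
    have hle : M' ≤ N := by
      rintro _ ⟨x, -, rfl⟩
      exact x.2
    rcases hN.le_iff.mp hle with h | h
    · left
      refine Subrepresentation.toSubmodule_injective ?_
      have : M.toSubmodule.map N.toSubmodule.subtype = ⊥ :=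
        congrArg Subrepresentation.toSubmodule h
      exact Submodule.map_injective_of_injective N.toSubmodule.injective_subtype
        (this.trans (Submodule.map_bot _).symm)
    · right
      refine Subrepresentation.toSubmodule_injective (eq_top_iff.mpr fun x _ => ?_)
      have : (x : W) ∈ M' := by
        rw [h]
        exact x.2
      obtain ⟨y, hy, hxy⟩ := this
      rwa [← Subtype.ext hxy]
  have : Nontrivial (Subrepresentation N.toRepresentation) := by
    refine ⟨⟨⊥, ⊤, fun h => hN.1 ?_⟩⟩
    refine Subrepresentation.toSubmodule_injective (eq_bot_iff.mpr fun x hx => ?_)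
    have h0 : (⟨x, hx⟩ : N.toSubmodule) ∈ (⊥ : Subrepresentation N.toRepresentation) := by
      rw [h]
      exact Submodule.mem_top
    exact congrArg Subtype.val (show (⟨x, hx⟩ : N.toSubmodule) = 0 from h0)
  exact ⟨key⟩

/-- Maschke's theorem: a finite-dimensional complex representation of a finite group is a finite
internal direct sum of irreducible subrepresentations. -/
theorem nonempty_irredDecomp [Finite G] [FiniteDimensional ℂ W] (ρ : Representation ℂ G W) :
    Nonempty (IrredDecomp ρ) := by
  have : NeZero (Nat.card G : ℂ) := ⟨Nat.cast_ne_zero.mpr Nat.card_pos.ne'⟩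
  have hss : IsSemisimpleModule (MonoidAlgebra ℂ G) ρ.asModule :=
    (isSemisimpleRepresentation_iff_isSemisimpleModule_asModule ρ).mp inferInstance
  have : Module.Finite ℂ ρ.asModule := inferInstanceAs (Module.Finite ℂ W)
  have : Module.Finite (MonoidAlgebra ℂ G) ρ.asModule :=
    Module.Finite.of_restrictScalars_finite ℂ _ _
  obtain ⟨s, hind, hsup, hs⟩ :=
    IsSemisimpleModule.exists_sSupIndep_sSup_simples_eq_top (MonoidAlgebra ℂ G) ρ.asModule
  have hind' := (sSupIndep_iff _).mp hind
  have : Finite s := WellFoundedGT.finite_of_iSupIndep hind' fun S => by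
    have := hs S S.2
    exact (S.1.nontrivial_iff_ne_bot).mp <| IsSimpleModule.nontrivial (MonoidAlgebra ℂ G) S
  let e := Finite.equivFin s
  have hint : DirectSum.IsInternal fun i =>
      (e.symm i : Submodule (MonoidAlgebra ℂ G) ρ.asModule) := by
    refine DirectSum.isInternal_submodule_of_iSupIndep_of_iSup_eq_top
      (hind'.comp e.symm.injective) ?_
    rw [← hsup, sSup_eq_iSup']
    exact e.symm.iSup_comp
  refine ⟨⟨Nat.card s, fun i => Subrepresentation.ofSubmodule' (e.symm i).1, fun i => ?_, hint⟩⟩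
  refine isIrreducible_of_isAtom ?_
  have := isSimpleModule_iff_isAtom.mp (hs _ (e.symm i).2)
  exact (OrderIso.isAtom_iff
    (Subrepresentation.subrepresentationSubmoduleOrderIso (ρ := ρ)).symm _).mpr this

/-- The multiplicity of a finite-dimensional irreducible `σ` in a finite-dimensional representation
`ρ` of a finite group is `dim Hom(σ, ρ)`. -/
theorem hasMultiplicity_finrank [Finite G] [FiniteDimensional ℂ W] [FiniteDimensional ℂ U]
    (ρ : Representation ℂ G W) (σ : Representation ℂ G U) [σ.IsIrreducible] :
    HasMultiplicity ρ σ (Module.finrank ℂ (IntertwiningMap σ ρ)) :=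
  ⟨nonempty_irredDecomp ρ, fun D => card_equiv_eq_finrank D σ⟩

/-- Two representations which permute bases indexed by the same set in the same way are
isomorphic. -/
theorem nonempty_equiv_of_basis {ι : Type*} {ρ : Representation ℂ G W}
    {ρ' : Representation ℂ G W'} (b : Module.Basis ι ℂ W) (b' : Module.Basis ι ℂ W')
    (a : G → ι → ι) (h : ∀ g i, ρ g (b i) = b (a g i)) (h' : ∀ g i, ρ' g (b' i) = b' (a g i)) :
    Nonempty (ρ.Equiv ρ') :=
  ⟨Representation.Equiv.mk (b.equiv b' (.refl ι)) fun g => b.ext fun i => by simp [h, h']⟩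

end Multiplicity

/-! ### Rearrangements and equivalences with prescribed fibres -/

section Rearrangement

theorem exists_equiv_of_card_fiber {α β γ : Type*} [Finite α] [Finite β] (f : α → γ) (g : β → γ)
    (h : ∀ c, Nat.card {a // f a = c} = Nat.card {b // g b = c}) :
    ∃ e : α ≃ β, ∀ a, g (e a) = f a := by
  have e : ∀ c, {a // f a = c} ≃ {b // g b = c} := fun c => (Finite.card_eq.mp (h c)).some
  refine ⟨(Equiv.sigmaFiberEquiv f).symm.trans
    ((Equiv.sigmaCongrRight e).trans (Equiv.sigmaFiberEquiv g)), fun a => ?_⟩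
  exact (e (f a) ⟨a, rfl⟩).2

variable {n : ℕ} {p q f : Fin n → ℕ}

/-- `f` is weakly increasing in the coordinate `q` on each level set of `p`. For `p` the row and `q`
the column of an entry of a tableau this says that `f` weakly increases along rows. -/
def IncreasingAlong (p q f : Fin n → ℕ) : Prop :=
  ∀ x y, p x = p y → q x < q y → f x ≤ f y

/-- The function which orders `Fin n` lexicographically by `p` and then `q`. -/
def lexCode (p q : Fin n → ℕ) (x : Fin n) : ℕ := q x + (∑ y, q y + 1) * p x

theorem le_sum_apply (q : Fin n → ℕ) (x : Fin n) : q x ≤ ∑ y, q y :=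
  Finset.single_le_sum (fun _ _ => Nat.zero_le _) (Finset.mem_univ x)

theorem lexCode_lt_of_lt {x y : Fin n} (h : p x < p y) : lexCode p q x < lexCode p q y := by
  have h1 := le_sum_apply q x
  have h2 := Nat.mul_le_mul_left (∑ z, q z + 1) h
  unfold lexCode
  rw [Nat.mul_succ] at h2
  omega

theorem IncreasingAlong.lexCode_le (hpq : ∀ x y, p x = p y → q x = q y → x = y)
    (hf : IncreasingAlong p q f) {x y : Fin n} (h : lexCode p q x ≤ lexCode p q y) :
    lexCode p f x ≤ lexCode p f y := by
  rcases lt_trichotomy (p x) (p y) with h1 | h1 | h1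
  · exact (lexCode_lt_of_lt h1).le
  · have h2 : q x ≤ q y := by
      unfold lexCode at h
      rw [h1] at h
      omega
    rcases h2.lt_or_eq with h3 | h3
    · have := hf x y h1 h3
      unfold lexCode
      rw [h1]
      omega
    · rw [hpq x y h1 h3]
  · exact absurd h (lexCode_lt_of_lt h1).not_ge

theorem lexCode_comp_perm {ρ : Equiv.Perm (Fin n)} (hρ : ∀ x, p (ρ x) = p x) (x : Fin n) :
    lexCode p (f ∘ ρ) x = lexCode p f (ρ x) := by
  unfold lexCode
  rw [hρ, Function.comp_apply]
  congr 3
  exact Equiv.sum_comp ρ f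

/-- The weakly increasing rearrangement within the level sets of `p` is unique. -/
theorem IncreasingAlong.comp_perm_eq (hpq : ∀ x y, p x = p y → q x = q y → x = y)
    (hf : IncreasingAlong p q f) {ρ : Equiv.Perm (Fin n)} (hρ : ∀ x, p (ρ x) = p x)
    (hfρ : IncreasingAlong p q (f ∘ ρ)) (x : Fin n) : f (ρ x) = f x := by
  have hm := Tuple.monotone_sort (lexCode p q)
  set s := Tuple.sort (lexCode p q)
  have h1 : Monotone (lexCode p f ∘ s) := fun a b hab => hf.lexCode_le hpq (hm hab)
  have h2 : Monotone (lexCode p f ∘ (ρ * s : Equiv.Perm (Fin n))) := by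
    intro a b hab
    have := hfρ.lexCode_le hpq (hm hab)
    rwa [lexCode_comp_perm hρ, lexCode_comp_perm hρ] at this
  have h := congrFun (Tuple.unique_monotone h2 h1) (s.symm x)
  simp only [Function.comp_apply, Equiv.Perm.coe_mul, Equiv.apply_symm_apply] at h
  unfold lexCode at h
  rw [hρ] at h
  omega

theorem sum_lexCode_mul_lexCode {ρ : Equiv.Perm (Fin n)} (hρ : ∀ x, p (ρ x) = p x) :
    ∑ x, lexCode p q x * lexCode p f (ρ x) + ∑ x, q x * f x =
      ∑ x, lexCode p q x * lexCode p f x + ∑ x, q x * f (ρ x) := by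
  have h : ∑ x, p x * f (ρ x) = ∑ x, p x * f x := by
    rw [← Equiv.sum_comp ρ fun x => p x * f x]
    simp only [hρ]
  unfold lexCode
  set A := ∑ y, q y + 1
  set B := ∑ y, f y + 1
  have h1 : ∀ g : Fin n → ℕ, ∑ x, (q x + A * p x) * (g x + B * p x) =
      ∑ x, q x * g x + A * ∑ x, p x * g x + ∑ x, (q x + A * p x) * (B * p x) := by
    intro g
    rw [Finset.mul_sum, ← Finset.sum_add_distrib, ← Finset.sum_add_distrib]
    exact Finset.sum_congr rfl fun x _ => by ring
  simp only [hρ]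
  rw [h1 fun x => f (ρ x), h1 f, h]
  ring

/-- The rearrangement inequality within the level sets of `p`. -/
theorem IncreasingAlong.sum_mul_comp_perm_le (hpq : ∀ x y, p x = p y → q x = q y → x = y)
    (hf : IncreasingAlong p q f) {ρ : Equiv.Perm (Fin n)} (hρ : ∀ x, p (ρ x) = p x) :
    ∑ x, q x * f (ρ x) ≤ ∑ x, q x * f x := by
  have hm : Monovary (lexCode p q) (lexCode p f) := fun x y h => by
    by_contra! h'
    exact absurd (hf.lexCode_le hpq h'.le) h.not_ge
  have h := hm.sum_mul_comp_perm_le_sum_mul (σ := ρ)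
  have := sum_lexCode_mul_lexCode (q := q) (f := f) hρ
  omega

/-- The equality case of the rearrangement inequality. -/
theorem IncreasingAlong.comp_perm_eq_of_sum_eq (hpq : ∀ x y, p x = p y → q x = q y → x = y)
    (hf : IncreasingAlong p q f) {ρ : Equiv.Perm (Fin n)} (hρ : ∀ x, p (ρ x) = p x)
    (hsum : ∑ x, q x * f (ρ x) = ∑ x, q x * f x) (x : Fin n) : f (ρ x) = f x := by
  have hm : Monovary (lexCode p q) (lexCode p f) := fun x y h => by
    by_contra! h'
    exact absurd (hf.lexCode_le hpq h'.le) h.not_ge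
  have h2 := sum_lexCode_mul_lexCode (q := q) (f := f) hρ
  have h3 : Monovary (lexCode p q) (lexCode p f ∘ ρ) :=
    (hm.sum_mul_comp_perm_eq_sum_mul_iff (σ := ρ)).mp (by omega)
  refine hf.comp_perm_eq hpq hρ (fun x y hp hq => ?_) x
  by_contra! h4
  have h5 : lexCode p q y ≤ lexCode p q x := h3 (show lexCode p f (ρ y) < lexCode p f (ρ x) by
    unfold lexCode
    rw [hρ, hρ, hp]
    simp only [Function.comp_apply] at h4
    omega)
  unfold lexCode at h5
  rw [hp] at h5
  omega

end Rearrangement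

/-! ### Tabloids as words -/

section Words

variable {n : ℕ} {mu : n.Partition}

theorem card_row_diagram (mu : n.Partition) (i : ℕ) :
    ((diagram mu).cells.filter fun c => c.1 = i).card = (partList mu).getD i 0 := by
  have h : ((diagram mu).cells.filter fun c => c.1 = i) =
      (Finset.range ((partList mu).getD i 0)).map
        ⟨fun j => (i, j), fun a b h => by simpa using h⟩ := by
    ext ⟨a, b⟩
    simp only [Finset.mem_filter, YoungDiagram.mem_cells, diagram, YoungDiagram.mem_ofRowLens,
      Finset.mem_map, Finset.mem_range]
    constructor
    · rintro ⟨⟨h1, h2⟩, rfl⟩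
      exact ⟨b, by rwa [List.getD_eq_getElem _ _ h1], rfl⟩
    · rintro ⟨j, h, hj⟩
      obtain ⟨rfl, rfl⟩ := Prod.ext_iff.mp hj
      have h1 : i < (partList mu).length := by
        by_contra! h1
        rw [List.getD_eq_default _ _ h1] at h
        omega
      exact ⟨⟨h1, by rwa [List.getD_eq_getElem _ _ h1] at h⟩, rfl⟩
  rw [h, Finset.card_map, Finset.card_range]

theorem sum_partList (mu : n.Partition) : (partList mu).sum = n := by
  have : ((partList mu : List ℕ) : Multiset ℕ).sum = n := by
    rw [partList, Multiset.sort_eq, mu.parts_sum]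
  simpa using this

theorem card_cells_diagram (mu : n.Partition) : (diagram mu).cells.card = n := by
  rw [Finset.card_eq_sum_card_fiberwise (f := Prod.fst)
    (t := Finset.range (partList mu).length)]
  · simp only [card_row_diagram]
    conv_rhs => rw [← sum_partList mu]
    rw [Finset.sum_range, ← Fin.sum_univ_getElem]
    exact Finset.sum_congr rfl fun i _ => List.getD_eq_getElem _ _ i.2
  · intro c hc
    obtain ⟨h, -⟩ := YoungDiagram.mem_ofRowLens.mp hc
    simpa using h

instance nonempty_tableau (mu : n.Partition) : Nonempty (Tableau mu) :=
  ⟨Fintype.equivFinOfCardEq (by simp [card_cells_diagram])⟩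

/-- The word of a tabloid: the function sending each entry to its row. -/
def rowWord (X : Tabloid mu) : Fin n → ℕ :=
  Quotient.lift rowOf (fun _ _ h => funext h) X

@[simp]
theorem rowWord_toTabloid (t : Tableau mu) : rowWord (toTabloid t) = rowOf t := rfl

theorem rowWord_smul (σ : Equiv.Perm (Fin n)) (X : Tabloid mu) (x : Fin n) :
    rowWord (σ • X) x = rowWord X (σ⁻¹ x) := by
  induction X using Quotient.inductionOn
  rfl

theorem rowWord_injective : Function.Injective (rowWord (mu := mu)) := by
  intro X Y h
  induction X using Quotient.inductionOn
  induction Y using Quotient.inductionOn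
  exact Quotient.sound fun x => congrFun h x

theorem card_rowOf (t : Tableau mu) (i : ℕ) :
    Nat.card {x // rowOf t x = i} = (partList mu).getD i 0 := by
  rw [← card_row_diagram, ← Nat.card_eq_finsetCard]
  refine Nat.card_congr ((t.symm.subtypeEquiv (q := fun c => c.1.1 = i) fun x => Iff.rfl).trans ?_)
  exact (Equiv.subtypeSubtypeEquivSubtypeInter (· ∈ (diagram mu).cells) fun c => c.1 = i).trans
    (Equiv.subtypeEquivRight fun c => by simp)

theorem card_rowWord (X : Tabloid mu) (i : ℕ) :
    Nat.card {x // rowWord X x = i} = (partList mu).getD i 0 := by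
  induction X using Quotient.inductionOn with
  | _ t => exact card_rowOf t i

/-- Every word of content `μ` is the word of a `μ`-tabloid. -/
theorem exists_rowWord_eq {f : Fin n → ℕ}
    (hf : ∀ i, Nat.card {x // f x = i} = (partList mu).getD i 0) :
    ∃ X : Tabloid mu, rowWord X = f := by
  obtain ⟨t⟩ := nonempty_tableau mu
  obtain ⟨e, he⟩ := exists_equiv_of_card_fiber (rowOf t) f fun i => by rw [card_rowOf, hf]
  refine ⟨toTabloid (actTableau e t), funext fun x => ?_⟩
  rw [rowWord_toTabloid, rowOf_act, ← he]
  exact congrArg f (e.apply_symm_apply x)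

instance finite_tabloid (mu : n.Partition) : Finite (Tabloid mu) :=
  inferInstanceAs (Finite (Quotient _))

end Words

/-! ### Coordinates on a tableau -/

section Coordinates

variable {n : ℕ} {lam mu : n.Partition} (t : Tableau lam)

theorem eq_of_rowOf_eq_of_colOf_eq {x y : Fin n} (h : rowOf t x = rowOf t y)
    (h' : colOf t x = colOf t y) : x = y :=
  t.symm.injective (Subtype.ext (Prod.ext h h'))

theorem cell_mem_diagram (x : Fin n) : (rowOf t x, colOf t x) ∈ diagram lam := (t.symm x).2

theorem exists_entry {i j : ℕ} (h : (i, j) ∈ diagram lam) :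
    ∃ x, rowOf t x = i ∧ colOf t x = j :=
  ⟨t ⟨(i, j), h⟩, by simp [rowOf], by simp [colOf]⟩

theorem mem_colStab_inv {π : Equiv.Perm (Fin n)} (hπ : π ∈ colStab t) : π⁻¹ ∈ colStab t := by
  rw [mem_colStab] at hπ ⊢
  intro x
  rw [← hπ (π⁻¹ x)]
  exact congrArg (colOf t) (π.apply_symm_apply x)

/-- A word is semistandard for the tableau `t` if it becomes a semistandard filling of the diagram
when each box is given the letter of the word at the entry of `t` in this box. -/
def IsSemistandard (f : Fin n → ℕ) : Prop :=
  IncreasingAlong (rowOf t) (colOf t) f ∧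
    ∀ x y, colOf t x = colOf t y → rowOf t x < rowOf t y → f x < f y

theorem IsSemistandard.increasingAlong_col {t : Tableau lam} {f : Fin n → ℕ}
    (hf : IsSemistandard t f) : IncreasingAlong (colOf t) (rowOf t) f :=
  fun x y h h' => (hf.2 x y h h').le

/-- The sum of column number times letter, over all entries. Among the words which agree up to row
permutations it is maximal exactly at the one that weakly increases along rows, and it does not
change under column permutations. -/
def colWeight (f : Fin n → ℕ) : ℕ := ∑ x, colOf t x * f x

theorem colWeight_comp_perm (f : Fin n → ℕ) {π : Equiv.Perm (Fin n)} (hπ : π ∈ colStab t) :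
    colWeight t (fun x => f (π x)) = colWeight t f := by
  unfold colWeight
  rw [← Equiv.sum_comp π fun x => colOf t x * f x]
  exact Finset.sum_congr rfl fun x _ => by rw [mem_colStab.mp hπ]

theorem rowWord_smul_eq (σ : Equiv.Perm (Fin n)) (X : Tabloid mu) :
    rowWord (σ • X) = fun x => rowWord X (σ⁻¹ x) :=
  funext (rowWord_smul σ X)

theorem colWeight_smul (X : Tabloid mu) {π : Equiv.Perm (Fin n)} (hπ : π ∈ colStab t) :
    colWeight t (rowWord (π • X)) = colWeight t (rowWord X) := by
  rw [rowWord_smul_eq]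
  exact colWeight_comp_perm t _ (mem_colStab_inv t hπ)

theorem sum_mul_comp_swap_lt {r f : Fin n → ℕ} {x y : Fin n} (hr : r x < r y) (hf : f y < f x) :
    ∑ z, r z * f z < ∑ z, r z * f (Equiv.swap x y z) := by
  have hxy : x ≠ y := fun h => hr.ne (congrArg r h)
  zify
  rw [← sub_pos, ← Finset.sum_sub_distrib, Finset.sum_eq_add x y hxy]
  · rw [Equiv.swap_apply_left, Equiv.swap_apply_right]
    zify at hr hf
    nlinarith
  · intro z _ hz
    rw [Equiv.swap_apply_of_ne_of_ne hz.1 hz.2, sub_self]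
  · simp
  · simp

end Coordinates

/-! ### Garnir relations -/

section Garnir

variable {n : ℕ} {lam mu : n.Partition} (t : Tableau lam)

/-- The permutations which fix every element outside of `E`. -/
def permsOn (E : Finset (Fin n)) : Finset (Equiv.Perm (Fin n)) :=
  {π | ∀ x, x ∉ E → π x = x}

theorem mem_permsOn {E : Finset (Fin n)} {π : Equiv.Perm (Fin n)} :
    π ∈ permsOn E ↔ ∀ x, x ∉ E → π x = x := by
  simp [permsOn]

/-- `E` cannot be brought into distinct rows by a column permutation of `t`. -/
def RowsCollide (E : Finset (Fin n)) : Prop :=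
  ∀ σ ∈ colStab t, ∃ x ∈ E, ∃ y ∈ E, x ≠ y ∧ rowOf t (σ⁻¹ x) = rowOf t (σ⁻¹ y)

theorem permModule_single (σ : Equiv.Perm (Fin n)) (X : Tabloid mu) (a : ℂ) :
    permModule mu σ (MonoidAlgebra.single X a) = MonoidAlgebra.single (σ • X) a :=
  Representation.ofMulAction_single ..

theorem coeff_permModule (σ : Equiv.Perm (Fin n)) (w : MonoidAlgebra ℂ (Tabloid mu))
    (X : Tabloid mu) : (permModule mu σ w).coeff X = w.coeff (σ⁻¹ • X) := by
  classical
  induction w using MonoidAlgebra.induction_linear with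
  | zero => simp
  | add x y hx hy => simp [hx, hy]
  | single Y a =>
    rw [permModule_single, MonoidAlgebra.coeff_single, MonoidAlgebra.coeff_single,
      Finsupp.single_apply, Finsupp.single_apply]
    simp only [eq_inv_smul_iff]

/-- The antisymmetrizer of a set of entries that must collide in rows kills the polytabloid. -/
theorem sum_sign_smul_polytabloid {E : Finset (Fin n)} (hE : RowsCollide t E) :
    ∑ π ∈ permsOn E, ((Equiv.Perm.sign π : ℤ) : ℂ) • permModule lam π (polytabloid t) = 0 := by
  simp only [polytabloid, map_sum, Finset.smul_sum, permModule_single]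
  rw [Finset.sum_comm]
  refine Finset.sum_eq_zero fun σ hσ => ?_
  obtain ⟨x, hx, y, hy, hxy, h⟩ := hE σ hσ
  have hfix : Equiv.swap x y • toTabloid (actTableau σ t) = toTabloid (actTableau σ t) := by
    refine rowWord_injective (funext fun z => ?_)
    rw [rowWord_smul, rowWord_toTabloid, rowOf_act, rowOf_act, Equiv.swap_inv]
    rcases eq_or_ne z x with rfl | hzx
    · rw [Equiv.swap_apply_left, h]
    rcases eq_or_ne z y with rfl | hzy
    · rw [Equiv.swap_apply_right, h]
    rw [Equiv.swap_apply_of_ne_of_ne hzx hzy]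
  -- Right multiplication by the transposition pairs off terms of opposite sign.
  refine Finset.sum_involution (fun π _ => π * Equiv.swap x y) ?_ ?_ ?_ ?_
  · intro π _
    rw [mul_smul, hfix, map_mul, Equiv.Perm.sign_swap hxy]
    simp
  · intro π _ _ h1
    exact hxy (Equiv.swap_eq_one_iff.mp (mul_eq_left.mp h1))
  · intro π hπ
    rw [mem_permsOn] at hπ ⊢
    intro z hz
    rw [Equiv.Perm.mul_apply, Equiv.swap_apply_of_ne_of_ne, hπ z hz]
    · rintro rfl
      exact hz hx
    · rintro rfl
      exact hz hy
  · intro π _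
    rw [mul_assoc, Equiv.swap_mul_self, mul_one]

theorem permModule_polytabloid_of_mem_colStab {π : Equiv.Perm (Fin n)} (hπ : π ∈ colStab t) :
    permModule lam π (polytabloid t) = ((Equiv.Perm.sign π : ℤ) : ℂ) • polytabloid t := by
  simp only [polytabloid, map_sum, Finset.smul_sum, permModule_single, smul_toTabloid]
  have hsq : ((Equiv.Perm.sign π : ℤ) : ℂ) * ((Equiv.Perm.sign π : ℤ) : ℂ) = 1 := by
    rw [← Int.cast_mul, Int.units_coe_mul_self, Int.cast_one]
  refine Finset.sum_bij' (fun σ _ => π * σ) (fun σ _ => π⁻¹ * σ) ?_ ?_ ?_ ?_ ?_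
  · intro σ hσ
    rw [mem_colStab] at hσ hπ ⊢
    intro x
    rw [Equiv.Perm.mul_apply, hπ, hσ]
  · intro σ hσ
    have hπ' := mem_colStab_inv t hπ
    rw [mem_colStab] at hσ hπ' ⊢
    intro x
    rw [Equiv.Perm.mul_apply, hπ', hσ]
  · intro σ _
    group
  · intro σ _
    group
  · intro σ _
    rw [MonoidAlgebra.smul_single, map_mul, Units.val_mul, Int.cast_mul, smul_eq_mul, ← mul_assoc,
      hsq, one_mul]
    rfl

/-- The Garnir set of two horizontally adjacent entries `x` and `y`: the entries weakly below `x` in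
its column and those weakly above `y` in the next column. -/
def garnirSet (x : Fin n) : Finset (Fin n) :=
  {z | (colOf t z = colOf t x ∧ rowOf t x ≤ rowOf t z) ∨
    (colOf t z = colOf t x + 1 ∧ rowOf t z ≤ rowOf t x)}

theorem mem_garnirSet {x z : Fin n} : z ∈ garnirSet t x ↔
    (colOf t z = colOf t x ∧ rowOf t x ≤ rowOf t z) ∨
      (colOf t z = colOf t x + 1 ∧ rowOf t z ≤ rowOf t x) := by
  simp [garnirSet]

/-- The Garnir set has one more element than the left one of the two columns has boxes. -/
theorem rowsCollide_garnirSet {x y : Fin n} (hrow : rowOf t y = rowOf t x)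
    (hcol : colOf t y = colOf t x + 1) : RowsCollide t (garnirSet t x) := by
  intro σ hσ
  have hσ' := mem_colStab.mp (mem_colStab_inv t hσ)
  set L := (diagram lam).colLen (colOf t x)
  have hg : ∀ m ∈ Finset.range (L + 1), ∃ z ∈ garnirSet t x,
      (m ≤ rowOf t x → colOf t z = colOf t x + 1 ∧ rowOf t z = m) ∧
      (rowOf t x < m → colOf t z = colOf t x ∧ rowOf t z = m - 1) := by
    intro m hm
    rw [Finset.mem_range] at hm
    rcases le_or_gt m (rowOf t x) with h | h
    · have hmem : (m, colOf t x + 1) ∈ diagram lam :=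
        (diagram lam).up_left_mem (h.trans hrow.ge) hcol.ge (cell_mem_diagram t y)
      obtain ⟨z, hz1, hz2⟩ := exists_entry t hmem
      refine ⟨z, (mem_garnirSet t).mpr (Or.inr ⟨hz2, by omega⟩), fun _ => ⟨hz2, hz1⟩, fun _ => ?_⟩
      omega
    · have hmem : (m - 1, colOf t x) ∈ diagram lam :=
        YoungDiagram.mem_iff_lt_colLen.mpr (show m - 1 < L by omega)
      obtain ⟨z, hz1, hz2⟩ := exists_entry t hmem
      refine ⟨z, (mem_garnirSet t).mpr (Or.inl ⟨hz2, by omega⟩), fun _ => ?_, fun _ => ⟨hz2, hz1⟩⟩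
      omega
  have : Nonempty (Fin n) := ⟨x⟩
  choose! g hgE hg1 hg2 using hg
  obtain ⟨a, ha, b, hb, hab, h⟩ := Finset.exists_ne_map_eq_of_card_lt_of_maps_to
    (s := Finset.range (L + 1)) (t := Finset.range L) (f := fun m => rowOf t (σ⁻¹ (g m)))
    (by simp) (by
      intro m hm
      have h1 := cell_mem_diagram t (σ⁻¹ (g m))
      rw [hσ'] at h1
      have h2 := YoungDiagram.mem_iff_lt_colLen.mp h1
      have h3 : (diagram lam).colLen (colOf t (g m)) ≤ L := by
        refine (diagram lam).colLen_anti _ _ ?_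
        rcases (mem_garnirSet t).mp (hgE m hm) with h4 | h4 <;> omega
      simp only [Finset.coe_range, Set.mem_Iio]
      omega)
  refine ⟨g a, hgE a ha, g b, hgE b hb, fun he => hab ?_, h⟩
  have ha1 := hg1 a ha
  have ha2 := hg2 a ha
  have hb1 := hg1 b hb
  have hb2 := hg2 b hb
  rw [he] at ha1 ha2
  omega

/-- A permutation of the Garnir set that moves entries between the two columns increases the column
weight, if all letters in the left part exceed all letters in the right part. -/
theorem colWeight_lt_of_mem_permsOn {x : Fin n} {f : Fin n → ℕ} {v : ℕ}
    (hA : ∀ z, colOf t z = colOf t x → rowOf t x ≤ rowOf t z → v ≤ f z)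
    (hB : ∀ z, colOf t z = colOf t x + 1 → rowOf t z ≤ rowOf t x → f z < v)
    {π : Equiv.Perm (Fin n)} (hπ : π ∈ permsOn (garnirSet t x)) (hπ' : π ∉ colStab t) :
    colWeight t f < colWeight t fun z => f (π z) := by
  have hfix := mem_permsOn.mp hπ
  have hmaps : ∀ z, π z ∈ garnirSet t x → z ∈ garnirSet t x := by
    intro z hz
    by_contra h
    rw [hfix z h] at hz
    exact h hz
  have hmem : ∀ z, z ∈ garnirSet t x → π z ∈ garnirSet t x := by
    intro z hz
    by_contra h
    have := π.injective (hfix _ h)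
    rw [this] at h
    exact h hz
  -- The letters are compared with the half-integer `v - 1/2`, doubled.
  have hnonneg : ∀ z, 0 ≤ ((colOf t z : ℤ) - colOf t (π z)) * (2 * f (π z) - (2 * v - 1)) ∧
      (colOf t (π z) ≠ colOf t z →
        0 < ((colOf t z : ℤ) - colOf t (π z)) * (2 * f (π z) - (2 * v - 1))) := by
    intro z
    by_cases hz : z ∈ garnirSet t x
    · have hz1 := (mem_garnirSet t).mp hz
      rcases (mem_garnirSet t).mp (hmem z hz) with h2 | h2
      · have h3 := hA _ h2.1 h2.2
        rcases hz1 with h1 | h1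
        · rw [h1.1, h2.1]
          simp
        · rw [h1.1, h2.1]
          push_cast
          refine ⟨?_, fun _ => ?_⟩ <;> · zify at h3; linarith
      · have h3 := hB _ h2.1 h2.2
        rcases hz1 with h1 | h1
        · rw [h1.1, h2.1]
          push_cast
          refine ⟨?_, fun _ => ?_⟩ <;> · zify at h3; linarith
        · rw [h1.1, h2.1]
          simp
    · rw [hfix z hz]
      simp
  obtain ⟨z, hz⟩ : ∃ z, colOf t (π z) ≠ colOf t z := by
    by_contra! h
    exact hπ' (mem_colStab.mpr h)
  have hpos : 0 < ∑ z, ((colOf t z : ℤ) - colOf t (π z)) * (2 * f (π z) - (2 * v - 1)) :=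
    Finset.sum_pos' (fun z _ => (hnonneg z).1) ⟨z, Finset.mem_univ z, (hnonneg z).2 hz⟩
  have h1 : ∑ z, (colOf t (π z) : ℤ) = ∑ z, (colOf t z : ℤ) :=
    Equiv.sum_comp π fun z => (colOf t z : ℤ)
  have h2 : ∑ z, (colOf t (π z) : ℤ) * f (π z) = ∑ z, (colOf t z : ℤ) * f z :=
    Equiv.sum_comp π fun z => (colOf t z : ℤ) * f z
  have h3 : ∑ z, ((colOf t z : ℤ) - colOf t (π z)) * (2 * f (π z) - (2 * v - 1)) =
      2 * ∑ z, (colOf t z : ℤ) * f (π z) - 2 * ∑ z, (colOf t (π z) : ℤ) * f (π z) -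
        (2 * v - 1) * (∑ z, (colOf t z : ℤ) - ∑ z, (colOf t (π z) : ℤ)) := by
    simp only [Finset.mul_sum, ← Finset.sum_sub_distrib]
    exact Finset.sum_congr rfl fun z _ => by ring
  rw [h3, h1, h2] at hpos
  unfold colWeight
  zify
  linarith

/-- A nonzero function on tabloids which is antisymmetric under the column stabilizer of `t` and
satisfies the Garnir relations does not vanish at all semistandard words: among the tabloids in its
support, one with lexicographically largest column weight and row weight is semistandard. -/
theorem exists_isSemistandard_of_ne_zero {u : Tabloid mu → ℂ}
    (hanti : ∀ π ∈ colStab t, ∀ X, u (π⁻¹ • X) = ((Equiv.Perm.sign π : ℤ) : ℂ) * u X)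
    (hgarnir : ∀ E, RowsCollide t E → ∀ X,
      ∑ π ∈ permsOn E, ((Equiv.Perm.sign π : ℤ) : ℂ) * u (π⁻¹ • X) = 0)
    (hu : ∃ X, u X ≠ 0) : ∃ X, IsSemistandard t (rowWord X) ∧ u X ≠ 0 := by
  classical
  have := Fintype.ofFinite (Tabloid mu)
  obtain ⟨X, hX, hmax⟩ := Finset.exists_max_image (Finset.univ.filter fun X => u X ≠ 0)
    (fun X => toLex (colWeight t (rowWord X), ∑ x, rowOf t x * rowWord X x))
    (hu.imp fun X hX => by simpa using hX)
  simp only [Finset.mem_filter, Finset.mem_univ, true_and] at hX hmax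
  have hcol : ∀ x y, colOf t x = colOf t y → rowOf t x < rowOf t y →
      rowWord X x < rowWord X y := by
    intro x y hc hr
    have hxy : x ≠ y := fun h => hr.ne (congrArg _ h)
    have hs : Equiv.swap x y ∈ colStab t := by
      rw [mem_colStab]
      intro z
      rcases eq_or_ne z x with rfl | hzx
      · rw [Equiv.swap_apply_left, hc]
      rcases eq_or_ne z y with rfl | hzy
      · rw [Equiv.swap_apply_right, hc]
      rw [Equiv.swap_apply_of_ne_of_ne hzx hzy]
    have hus : u (Equiv.swap x y • X) = -u X := by
      have := hanti _ hs X
      rw [Equiv.swap_inv, Equiv.Perm.sign_swap hxy] at this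
      simpa using this
    by_contra! h
    rcases h.lt_or_eq with h | h
    · have h1 := hmax (Equiv.swap x y • X) (by rw [hus]; exact neg_ne_zero.mpr hX)
      rw [colWeight_smul t X hs, rowWord_smul_eq, Equiv.swap_inv, Prod.Lex.toLex_le_toLex] at h1
      rcases h1 with h1 | h1
      · exact lt_irrefl _ h1
      · exact absurd (sum_mul_comp_swap_lt hr h) h1.2.not_gt
    · have : Equiv.swap x y • X = X := by
        refine rowWord_injective (funext fun z => ?_)
        rw [rowWord_smul, Equiv.swap_inv]
        rcases eq_or_ne z x with rfl | hzx
        · rw [Equiv.swap_apply_left, h]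
        rcases eq_or_ne z y with rfl | hzy
        · rw [Equiv.swap_apply_right, h]
        rw [Equiv.swap_apply_of_ne_of_ne hzx hzy]
      rw [this] at hus
      exact hX (self_eq_neg.mp hus)
  have hcol' : ∀ x y, colOf t x = colOf t y → rowOf t x ≤ rowOf t y →
      rowWord X x ≤ rowWord X y := by
    intro x y hc hr
    rcases hr.lt_or_eq with h | h
    · exact (hcol x y hc h).le
    · rw [eq_of_rowOf_eq_of_colOf_eq t h hc]
  have hadj : ∀ x y, rowOf t y = rowOf t x → colOf t y = colOf t x + 1 →
      rowWord X x ≤ rowWord X y := by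
    intro x y hr hc
    by_contra! h
    have hg := hgarnir _ (rowsCollide_garnirSet t hr hc) X
    -- By maximality only the permutations which preserve the columns contribute.
    rw [← Finset.sum_filter_add_sum_filter_not _ (· ∈ colStab t)] at hg
    rw [Finset.sum_eq_zero (s := Finset.filter (fun π => π ∉ colStab t) _), add_zero] at hg
    · rw [Finset.sum_congr rfl (g := fun _ => u X), Finset.sum_const, nsmul_eq_mul] at hg
      · rcases mul_eq_zero.mp hg with h0 | h0
        · rw [Nat.cast_eq_zero, Finset.card_eq_zero] at h0
          refine Finset.notMem_empty (1 : Equiv.Perm (Fin n)) (h0 ▸ ?_)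
          rw [Finset.mem_filter, mem_permsOn, mem_colStab]
          exact ⟨fun _ _ => rfl, fun _ => rfl⟩
        · exact hX h0
      · intro π hπ
        rw [hanti π (Finset.mem_filter.mp hπ).2, ← mul_assoc, ← Int.cast_mul,
          Int.units_coe_mul_self, Int.cast_one, one_mul]
    · intro π hπ
      obtain ⟨hπ1, hπ2⟩ := Finset.mem_filter.mp hπ
      have hlt := colWeight_lt_of_mem_permsOn t (v := rowWord X x) (f := rowWord X)
        (fun z hz1 hz2 => hcol' x z hz1.symm hz2)
        (fun z hz1 hz2 => (hcol' z y (hz1.trans hc.symm) (hz2.trans hr.ge)).trans_lt h) hπ1 hπ2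
      by_contra h0
      have h1 := hmax (π⁻¹ • X) (right_ne_zero_of_mul h0)
      rw [rowWord_smul_eq, inv_inv, Prod.Lex.toLex_le_toLex] at h1
      simp only at h1
      omega
  refine ⟨X, ⟨?_, hcol⟩, hX⟩
  have hrow : ∀ d x y, rowOf t x = rowOf t y → colOf t y = colOf t x + d →
      rowWord X x ≤ rowWord X y := by
    intro d
    induction d with
    | zero =>
      intro x y hr hc
      rw [eq_of_rowOf_eq_of_colOf_eq t hr hc.symm]
    | succ d ih =>
      intro x y hr hc
      obtain ⟨z, hz1, hz2⟩ := exists_entry t ((diagram lam).up_left_mem le_rfl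
        (show colOf t x + d ≤ colOf t y by omega) (cell_mem_diagram t y))
      exact (ih x z (hr.trans hz1.symm) hz2).trans (hadj z y hz1.symm (by omega))
  intro x y hr hc
  exact hrow (colOf t y - colOf t x) x y hr (by omega)

end Garnir

/-! ### Homomorphisms from Specht modules to permutation modules -/

section SpechtHom

open Representation

variable {n : ℕ} {lam mu : n.Partition} (t : Tableau lam)

/-- The polytabloid of `t` as an element of the Specht module, which it generates. -/
noncomputable def spechtGen : (spechtSub lam).toSubmodule :=
  ⟨polytabloid t, Submodule.subset_span ⟨t, rfl⟩⟩

theorem specht_spechtGen (σ : Equiv.Perm (Fin n)) :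
    specht lam σ (spechtGen t) = spechtGen (actTableau σ t) :=
  Subtype.ext (permModule_polytabloid σ t)

theorem hom_ext_spechtGen {θ θ' : IntertwiningMap (specht lam) (permModule mu)}
    (h : θ (spechtGen t) = θ' (spechtGen t)) : θ = θ' := by
  have hgen : ∀ s : Tableau lam, θ (spechtGen s) = θ' (spechtGen s) := by
    intro s
    have hs : s = actTableau (t.symm.trans s) t := by
      ext c
      simp [actTableau]
    rw [hs, ← specht_spechtGen, θ.isIntertwining, θ'.isIntertwining, h]
  ext ⟨w, hw⟩ : 2
  change θ ⟨w, hw⟩ = θ' ⟨w, hw⟩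
  induction hw using Submodule.span_induction with
  | mem w hw =>
    obtain ⟨s, rfl⟩ := hw
    exact hgen s
  | zero => exact (map_zero θ).trans (map_zero θ').symm
  | add x y hx hy ihx ihy =>
    exact (map_add θ ⟨x, hx⟩ ⟨y, hy⟩).trans
      ((congrArg₂ _ ihx ihy).trans (map_add θ' ⟨x, hx⟩ ⟨y, hy⟩).symm)
  | smul a x hx ih =>
    exact (map_smul θ a ⟨x, hx⟩).trans
      ((congrArg _ ih).trans (map_smul θ' a ⟨x, hx⟩).symm)

/-- The tabloids of shape `μ` whose word is semistandard for `t`. -/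
abbrev SemistandardTabloid (mu : n.Partition) : Type :=
  {X : Tabloid mu // IsSemistandard t (rowWord X)}

/-- The coefficients of the image of the polytabloid of `t` at the semistandard tabloids. -/
noncomputable def semistandardCoeff (mu : n.Partition) :
    IntertwiningMap (specht lam) (permModule mu) →ₗ[ℂ] SemistandardTabloid t mu → ℂ where
  toFun θ X := (θ (spechtGen t)).coeff X.1
  map_add' _ _ := rfl
  map_smul' _ _ := rfl

theorem exists_isSemistandard_coeff_ne_zero
    {θ : IntertwiningMap (specht lam) (permModule mu)} (hθ : θ ≠ 0) :
    ∃ X, IsSemistandard t (rowWord X) ∧ (θ (spechtGen t)).coeff X ≠ 0 := by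
  refine exists_isSemistandard_of_ne_zero t ?_ ?_ ?_
  · intro π hπ X
    have h : specht lam π (spechtGen t) = ((Equiv.Perm.sign π : ℤ) : ℂ) • spechtGen t :=
      Subtype.ext (permModule_polytabloid_of_mem_colStab t hπ)
    rw [← coeff_permModule, ← θ.isIntertwining, h, map_smul]
    rfl
  · intro E hE X
    have h : ∑ π ∈ permsOn E, ((Equiv.Perm.sign π : ℤ) : ℂ) • specht lam π (spechtGen t) = 0 := by
      refine Subtype.ext ?_
      rw [AddSubmonoidClass.coe_finsetSum]
      exact sum_sign_smul_polytabloid t hE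
    have h2 := congrArg (fun w => (θ w).coeff X) h
    simp only [map_sum, map_smul, θ.isIntertwining, map_zero, MonoidAlgebra.coeff_sum,
      MonoidAlgebra.coeff_smul, Finsupp.finsetSum_apply, Finsupp.smul_apply, coeff_permModule,
      smul_eq_mul, MonoidAlgebra.coeff_zero, Finsupp.zero_apply] at h2
    exact h2
  · by_contra! h
    refine hθ (hom_ext_spechtGen t ?_)
    refine MonoidAlgebra.ext (Finsupp.ext fun X => ?_)
    rw [h X]
    rfl

theorem semistandardCoeff_injective : Function.Injective (semistandardCoeff t mu) := by
  rw [← LinearMap.ker_eq_bot, LinearMap.ker_eq_bot']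
  intro θ hθ
  by_contra h
  obtain ⟨X, hX, hX'⟩ := exists_isSemistandard_coeff_ne_zero t h
  exact hX' (congrFun hθ ⟨X, hX⟩)

open Classical in
/-- The linear map `M(λ) → M(μ)` which sends a tabloid `Y` to the sum of all `σ X` with
`σ {t} = Y`. -/
noncomputable def orbitSum (X : Tabloid mu) :
    MonoidAlgebra ℂ (Tabloid lam) →ₗ[ℂ] MonoidAlgebra ℂ (Tabloid mu) :=
  Finsupp.linearCombination ℂ (fun Y => ∑ σ : Equiv.Perm (Fin n) with σ • toTabloid t = Y,
    MonoidAlgebra.single (σ • X) (1 : ℂ)) ∘ₗ (MonoidAlgebra.coeffLinearEquiv ℂ).toLinearMap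

open Classical in
theorem orbitSum_single (X : Tabloid mu) (Y : Tabloid lam) (a : ℂ) :
    orbitSum t X (MonoidAlgebra.single Y a) =
      a • ∑ σ : Equiv.Perm (Fin n) with σ • toTabloid t = Y,
        MonoidAlgebra.single (σ • X) (1 : ℂ) :=
  Finsupp.linearCombination_single ..

theorem orbitSum_permModule (X : Tabloid mu) (τ : Equiv.Perm (Fin n))
    (w : MonoidAlgebra ℂ (Tabloid lam)) :
    orbitSum t X (permModule lam τ w) = permModule mu τ (orbitSum t X w) := by
  classical
  induction w using MonoidAlgebra.induction_linear with
  | zero => simp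
  | add x y hx hy => simp [hx, hy]
  | single Y a =>
    rw [permModule_single, orbitSum_single, orbitSum_single, map_smul, map_sum]
    congr 1
    simp only [permModule_single]
    refine Finset.sum_bij' (fun σ _ => τ⁻¹ * σ) (fun σ _ => τ * σ) ?_ ?_ ?_ ?_ ?_
    · intro σ hσ
      simp only [Finset.mem_filter, Finset.mem_univ, true_and] at hσ ⊢
      rw [mul_smul, hσ, inv_smul_smul]
    · intro σ hσ
      simp only [Finset.mem_filter, Finset.mem_univ, true_and] at hσ ⊢
      rw [mul_smul, hσ]
    · intro σ _
      group
    · intro σ _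
      group
    · intro σ _
      rw [← mul_smul, mul_inv_cancel_left]

/-- The intertwining map `S(λ) → M(μ)` attached to a tabloid of shape `μ`. -/
noncomputable def orbitHom (X : Tabloid mu) :
    IntertwiningMap (specht lam) (permModule mu) :=
  LinearMap.intertwiningMap_of_isIntertwiningMap (specht lam) (permModule mu)
    (orbitSum t X ∘ₗ (spechtSub lam).toSubmodule.subtype)
    fun σ w => orbitSum_permModule t X σ w

open Classical in
theorem coeff_orbitHom (X Z : Tabloid mu) :
    (orbitHom t X (spechtGen t)).coeff Z = ∑ π ∈ colStab t,
      ∑ σ : Equiv.Perm (Fin n) with σ • toTabloid t = π • toTabloid t,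
        if σ • X = Z then ((Equiv.Perm.sign π : ℤ) : ℂ) else 0 := by
  change (orbitSum t X (polytabloid t)).coeff Z = _
  rw [polytabloid, map_sum, MonoidAlgebra.coeff_sum, Finsupp.finsetSum_apply]
  refine Finset.sum_congr rfl fun π _ => ?_
  rw [orbitSum_single, MonoidAlgebra.coeff_smul, Finsupp.smul_apply, MonoidAlgebra.coeff_sum,
    Finsupp.finsetSum_apply, Finset.smul_sum]
  refine Finset.sum_congr rfl fun σ _ => ?_
  rw [MonoidAlgebra.coeff_single, Finsupp.single_apply, smul_eq_mul, mul_ite, mul_one, mul_zero]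

/-- Two semistandard tabloids which agree up to a row and a column permutation are equal, if the
second one has at least the column weight of the first one; moreover the column permutation is
trivial. -/
theorem eq_of_smul_eq_of_colWeight_le {X Z : Tabloid mu} (hX : IsSemistandard t (rowWord X))
    (hZ : IsSemistandard t (rowWord Z))
    (hle : colWeight t (rowWord X) ≤ colWeight t (rowWord Z)) {π σ : Equiv.Perm (Fin n)}
    (hπ : π ∈ colStab t) (hσ : σ • toTabloid t = π • toTabloid t) (hσX : σ • X = Z) :
    X = Z ∧ π = 1 := by
  obtain ⟨ρ, rfl⟩ : ∃ ρ, σ = π * ρ⁻¹ := ⟨σ⁻¹ * π, by group⟩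
  rw [mul_smul] at hσ hσX
  have hρ : ρ • toTabloid t = toTabloid t := by
    rw [← smul_left_cancel _ hσ, smul_inv_smul, smul_left_cancel _ hσ]
  have hrow : ∀ x, rowOf t (ρ x) = rowOf t x := by
    intro x
    have h := congrFun (congrArg rowWord hρ) (ρ x)
    rw [rowWord_smul, rowWord_toTabloid] at h
    rw [← h]
    exact congrArg (rowOf t) (ρ.symm_apply_apply x)
  have hw : colWeight t (rowWord (ρ⁻¹ • X)) = colWeight t (rowWord Z) := by
    rw [← hσX, colWeight_smul t _ hπ]
  have hXρ : ρ⁻¹ • X = X := by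
    refine rowWord_injective (funext fun x => ?_)
    rw [rowWord_smul, inv_inv]
    rw [rowWord_smul_eq, inv_inv] at hw
    refine hX.1.comp_perm_eq_of_sum_eq (fun x y => eq_of_rowOf_eq_of_colOf_eq t) hrow
      (le_antisymm ?_ (hle.trans hw.ge)) x
    exact hX.1.sum_mul_comp_perm_le (fun x y => eq_of_rowOf_eq_of_colOf_eq t) hrow
  rw [hXρ] at hσX
  have hcol := mem_colStab.mp (mem_colStab_inv t hπ)
  have hword : ∀ x, rowWord X (π⁻¹ x) = rowWord Z x := fun x => by rw [← hσX, rowWord_smul]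
  have hfix : ∀ x, rowWord X (π⁻¹ x) = rowWord X x := by
    refine hX.increasingAlong_col.comp_perm_eq
      (fun x y h h' => eq_of_rowOf_eq_of_colOf_eq t h' h) hcol ?_
    rw [show rowWord X ∘ ⇑π⁻¹ = rowWord Z from funext hword]
    exact hZ.increasingAlong_col
  refine ⟨rowWord_injective (funext fun x => (hfix x).symm.trans (hword x)), ?_⟩
  rw [← inv_eq_one]
  refine Equiv.ext fun x => eq_of_rowOf_eq_of_colOf_eq t ?_ (hcol x)
  rcases lt_trichotomy (rowOf t (π⁻¹ x)) (rowOf t x) with h | h | h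
  · exact absurd (hfix x) (hX.2 _ _ (hcol x) h).ne
  · exact h
  · exact absurd (hfix x) (hX.2 _ _ (hcol x).symm h).ne'

theorem coeff_orbitHom_eq_zero {X Z : Tabloid mu} (hX : IsSemistandard t (rowWord X))
    (hZ : IsSemistandard t (rowWord Z))
    (hle : colWeight t (rowWord X) ≤ colWeight t (rowWord Z)) (hne : X ≠ Z) :
    (orbitHom t X (spechtGen t)).coeff Z = 0 := by
  classical
  rw [coeff_orbitHom]
  refine Finset.sum_eq_zero fun π hπ => Finset.sum_eq_zero fun σ hσ => if_neg fun h => hne ?_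
  exact (eq_of_smul_eq_of_colWeight_le t hX hZ hle hπ (Finset.mem_filter.mp hσ).2 h).1

theorem coeff_orbitHom_self_ne_zero {X : Tabloid mu} (hX : IsSemistandard t (rowWord X)) :
    (orbitHom t X (spechtGen t)).coeff X ≠ 0 := by
  classical
  rw [coeff_orbitHom, Finset.sum_eq_single 1]
  · rw [← Finset.sum_filter, Finset.sum_const, nsmul_eq_mul, map_one, Units.val_one, Int.cast_one,
      mul_one, Nat.cast_ne_zero, Finset.card_ne_zero]
    exact ⟨1, by simp⟩
  · intro π hπ hne
    refine Finset.sum_eq_zero fun σ hσ => if_neg fun h => hne ?_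
    exact (eq_of_smul_eq_of_colWeight_le t hX hX le_rfl hπ (Finset.mem_filter.mp hσ).2 h).2
  · intro h
    exact absurd (mem_colStab.mpr fun _ => rfl) h

theorem linearIndependent_orbitHom :
    LinearIndependent ℂ fun X : SemistandardTabloid t mu => orbitHom t X.1 := by
  classical
  have := Fintype.ofFinite (SemistandardTabloid t mu)
  rw [Fintype.linearIndependent_iff]
  intro g hg
  by_contra! hne
  -- The matrix of coefficients is triangular with respect to the column weight.
  obtain ⟨X, hX, hmax⟩ := Finset.exists_max_image (Finset.univ.filter fun X => g X ≠ 0)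
    (fun X => colWeight t (rowWord X.1)) (hne.imp fun X hX => by simpa using hX)
  simp only [Finset.mem_filter, Finset.mem_univ, true_and] at hX hmax
  have h := congrFun (congrArg (semistandardCoeff t mu) hg) X
  rw [map_sum, Finset.sum_apply, map_zero, Pi.zero_apply, Finset.sum_eq_single X] at h
  · rw [map_smul, Pi.smul_apply, smul_eq_mul] at h
    exact mul_ne_zero hX (coeff_orbitHom_self_ne_zero t X.2) h
  · intro Y _ hYX
    rw [map_smul, Pi.smul_apply, smul_eq_mul]
    by_cases hY : g Y = 0
    · rw [hY, zero_mul]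
    · have : semistandardCoeff t mu (orbitHom t Y.1) X = 0 :=
        coeff_orbitHom_eq_zero t Y.2 X.2 (hmax Y hY) fun h => hYX (Subtype.ext h)
      rw [this, mul_zero]
  · simp

instance finiteDimensional_permModule (mu : n.Partition) :
    FiniteDimensional ℂ (MonoidAlgebra ℂ (Tabloid mu)) :=
  Module.Finite.equiv (MonoidAlgebra.coeffLinearEquiv ℂ).symm

theorem finrank_hom_eq_card (mu : n.Partition) :
    Module.finrank ℂ (IntertwiningMap (specht lam) (permModule mu)) =
      Nat.card (SemistandardTabloid t mu) := by
  classical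
  have := Fintype.ofFinite (SemistandardTabloid t mu)
  rw [Nat.card_eq_fintype_card]
  refine le_antisymm ?_ (linearIndependent_orbitHom t).fintype_card_le_finrank
  have := LinearMap.finrank_le_finrank_of_injective (semistandardCoeff_injective t (mu := mu))
  rwa [Module.finrank_fintype_fun_eq_card] at this

end SpechtHom

/-! ### Kostka numbers and irreducibility of Specht modules -/

section Kostka

open Representation

variable {n : ℕ} {lam mu : n.Partition} (t : Tableau lam)

theorem card_filter_cells_eq (T : ℕ → ℕ → ℕ) (i : ℕ) :
    ((diagram lam).cells.filter fun c => T c.1 c.2 = i).card =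
      Nat.card {x // T (rowOf t x) (colOf t x) = i} := by
  rw [← Nat.card_eq_finsetCard]
  refine Nat.card_congr (Equiv.symm ?_)
  refine (t.symm.subtypeEquiv (q := fun c => T c.1.1 c.1.2 = i) fun x => Iff.rfl).trans ?_
  exact (Equiv.subtypeSubtypeEquivSubtypeInter (· ∈ (diagram lam).cells)
    fun c => T c.1 c.2 = i).trans (Equiv.subtypeEquivRight fun c => by simp)

theorem sstd_entry_injective {S T : SStd lam mu}
    (h : ∀ x, S.1 (rowOf t x) (colOf t x) = T.1 (rowOf t x) (colOf t x)) : S = T := by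
  refine Subtype.ext (SemistandardYoungTableau.ext fun i j => ?_)
  by_cases hc : (i, j) ∈ diagram lam
  · obtain ⟨x, rfl, rfl⟩ := exists_entry t hc
    exact h x
  · rw [S.1.zeros hc, T.1.zeros hc]

theorem exists_semistandardTabloid (T : SStd lam mu) :
    ∃ X : SemistandardTabloid t mu, rowWord X.1 = fun x => T.1 (rowOf t x) (colOf t x) := by
  obtain ⟨X, hX⟩ := exists_rowWord_eq (mu := mu) (f := fun x => T.1 (rowOf t x) (colOf t x))
    fun i => by rw [← card_filter_cells_eq t (fun i j => T.1 i j), T.2]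
  refine ⟨⟨X, ?_⟩, hX⟩
  rw [hX]
  constructor
  · intro x y hr hc
    simp only
    rw [hr]
    exact T.1.row_weak hc (cell_mem_diagram t y)
  · intro x y hc hr
    simp only
    rw [hc]
    exact T.1.col_strict hr (cell_mem_diagram t y)

open Classical in
/-- The semistandard filling given by a semistandard tabloid. -/
noncomputable def SemistandardTabloid.toSStd (X : SemistandardTabloid t mu) : SStd lam mu :=
  have hval : ∀ x, (if h : (rowOf t x, colOf t x) ∈ (diagram lam).cells then
      rowWord X.1 (t ⟨(rowOf t x, colOf t x), h⟩) else 0) = rowWord X.1 x := fun x => by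
    rw [dif_pos (show (rowOf t x, colOf t x) ∈ (diagram lam).cells from cell_mem_diagram t x)]
    exact congrArg _ (t.apply_symm_apply x)
  ⟨{ entry := fun i j =>
        if h : (i, j) ∈ (diagram lam).cells then rowWord X.1 (t ⟨(i, j), h⟩) else 0
     row_weak' := by
      intro i j1 j2 hj hc
      obtain ⟨x, rfl, hx⟩ := exists_entry t ((diagram lam).up_left_mem le_rfl hj.le hc)
      obtain ⟨y, hy, rfl⟩ := exists_entry t hc
      subst hx
      have h1 := hval x
      have h2 := hval y
      rw [hy] at h2
      rw [h1, h2]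
      exact X.2.1 x y hy.symm hj
     col_strict' := by
      intro i1 i2 j hi hc
      obtain ⟨x, hx, rfl⟩ := exists_entry t ((diagram lam).up_left_mem hi.le le_rfl hc)
      obtain ⟨y, rfl, hy⟩ := exists_entry t hc
      subst hx
      have h1 := hval x
      have h2 := hval y
      rw [hy] at h2
      rw [h1, h2]
      exact X.2.2 x y hy.symm hi
     zeros' := fun {i j} h => dif_neg h }, fun i => by
    refine (card_filter_cells_eq t (fun i j => if h : (i, j) ∈ (diagram lam).cells then
      rowWord X.1 (t ⟨(i, j), h⟩) else 0) i).trans ?_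
    rw [← card_rowWord X.1 i]
    exact Nat.card_congr (Equiv.subtypeEquivRight fun x => by rw [hval x])⟩

theorem SemistandardTabloid.toSStd_apply (X : SemistandardTabloid t mu) (x : Fin n) :
    (X.toSStd t).1 (rowOf t x) (colOf t x) = rowWord X.1 x := by
  refine (dif_pos (show (rowOf t x, colOf t x) ∈ (diagram lam).cells from
    cell_mem_diagram t x)).trans ?_
  exact congrArg _ (t.apply_symm_apply x)

theorem card_semistandardTabloid (mu : n.Partition) :
    Nat.card (SemistandardTabloid t mu) = kostka lam mu := by
  refine Nat.card_eq_of_bijective (SemistandardTabloid.toSStd t) ⟨fun X Y h => ?_, fun T => ?_⟩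
  · refine Subtype.ext (rowWord_injective (funext fun x => ?_))
    rw [← X.toSStd_apply, ← Y.toSStd_apply, h]
  · obtain ⟨X, hX⟩ := exists_semistandardTabloid t T
    exact ⟨X, sstd_entry_injective t fun x => by rw [X.toSStd_apply, hX]⟩

/-- The homomorphisms from a Specht module to a permutation module are counted by the Kostka
number. -/
theorem finrank_hom_specht_permModule (lam mu : n.Partition) :
    Module.finrank ℂ (IntertwiningMap (specht lam) (permModule mu)) = kostka lam mu := by
  obtain ⟨t⟩ := nonempty_tableau lam
  rw [finrank_hom_eq_card t, card_semistandardTabloid]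

theorem rowOf_le_of_strict {f : Fin n → ℕ}
    (hf : ∀ x y, colOf t x = colOf t y → rowOf t x < rowOf t y → f x < f y) :
    ∀ i x, rowOf t x = i → i ≤ f x := by
  intro i
  induction i with
  | zero => intro x _; exact Nat.zero_le _
  | succ i ih =>
    intro x hx
    obtain ⟨y, hy1, hy2⟩ := exists_entry t ((diagram lam).up_left_mem
      (show i ≤ rowOf t x by omega) le_rfl (cell_mem_diagram t x))
    exact (ih y hy1).trans_lt (hf y x hy2 (by omega))

/-- The only semistandard tabloid of shape `λ` for `t` is `{t}`: the letter of an entry is at least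
the row of the entry, and the sums of both are the same. -/
theorem subsingleton_semistandardTabloid_self : Subsingleton (SemistandardTabloid t lam) := by
  suffices h : ∀ X : SemistandardTabloid t lam, rowWord X.1 = rowOf t from
    ⟨fun X Y => Subtype.ext (rowWord_injective ((h X).trans (h Y).symm))⟩
  intro X
  have hle : ∀ x ∈ Finset.univ, rowOf t x ≤ rowWord X.1 x := fun x _ =>
    rowOf_le_of_strict t X.2.2 _ x rfl
  obtain ⟨e, he⟩ := exists_equiv_of_card_fiber (rowOf t) (rowWord X.1) fun i => by
    rw [card_rowOf, card_rowWord]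
  have hsum : ∑ x, rowOf t x = ∑ x, rowWord X.1 x := by
    rw [← Equiv.sum_comp e fun x => rowWord X.1 x]
    exact Finset.sum_congr rfl fun x _ => (he x).symm
  exact funext fun x => ((Finset.sum_eq_sum_iff_of_le hle).mp hsum x (Finset.mem_univ x)).symm

theorem polytabloid_ne_zero : polytabloid t ≠ 0 := by
  classical
  intro h
  have h1 := congrArg (fun w => w.coeff (toTabloid t)) h
  simp only [polytabloid, MonoidAlgebra.coeff_sum, Finsupp.finsetSum_apply,
    MonoidAlgebra.coeff_single, Finsupp.single_apply, MonoidAlgebra.coeff_zero,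
    Finsupp.zero_apply] at h1
  rw [Finset.sum_eq_single 1] at h1
  · rw [if_pos (show toTabloid (actTableau 1 t) = toTabloid t from rfl), map_one, Units.val_one,
      Int.cast_one] at h1
    exact one_ne_zero h1
  · intro π hπ hne
    refine if_neg fun h2 => hne ?_
    rw [← inv_eq_one]
    refine Equiv.ext fun x => eq_of_rowOf_eq_of_colOf_eq t ?_ ?_
    · exact congrFun (congrArg rowWord h2) x
    · exact mem_colStab.mp (mem_colStab_inv t hπ) x
  · intro h2
    exact absurd (mem_colStab.mpr fun _ => rfl) h2

/-- The Specht module is irreducible, as all its intertwining maps to `M(λ)` are multiples of the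
inclusion, so that the projection to any direct summand is a scalar. -/
theorem isIrreducible_specht (lam : n.Partition) : (specht lam).IsIrreducible := by
  obtain ⟨t⟩ := nonempty_tableau lam
  let incl : IntertwiningMap (specht lam) (permModule lam) :=
    LinearMap.intertwiningMap_of_isIntertwiningMap (specht lam) (permModule lam)
      (spechtSub lam).toSubmodule.subtype fun _ _ => rfl
  have hone : Module.finrank ℂ (IntertwiningMap (specht lam) (permModule lam)) ≤ 1 := by
    rw [finrank_hom_eq_card t]
    exact Finite.card_le_one_iff_subsingleton.mpr (subsingleton_semistandardTabloid_self t)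
  have hgen : spechtGen t ≠ 0 := fun h => polytabloid_ne_zero t (congrArg Subtype.val h)
  have hincl : incl ≠ 0 := fun h => polytabloid_ne_zero t
    (congrArg (fun θ : IntertwiningMap (specht lam) (permModule lam) => θ (spechtGen t)) h)
  have hscalar : ∀ θ : IntertwiningMap (specht lam) (specht lam), ∃ a : ℂ, ∀ w, θ w = a • w := by
    intro θ
    obtain ⟨a, ha⟩ := (finrank_eq_one_iff_of_nonzero' incl hincl).mp
      (le_antisymm hone (Module.finrank_pos_iff_exists_ne_zero.mpr ⟨incl, hincl⟩)) (incl.comp θ)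
    refine ⟨a, fun w => Subtype.ext ?_⟩
    exact (congrArg (fun η : IntertwiningMap (specht lam) (permModule lam) => η w) ha).symm
  have hcard : NeZero (Nat.card (Equiv.Perm (Fin n)) : ℂ) :=
    ⟨Nat.cast_ne_zero.mpr Nat.card_pos.ne'⟩
  have hnt : Nontrivial (Subrepresentation (specht lam)) := by
    refine ⟨⊥, ⊤, fun h => hgen ?_⟩
    have : spechtGen t ∈ (⊥ : Subrepresentation (specht lam)) := by
      rw [h]
      exact Submodule.mem_top
    exact this
  refine ⟨fun N => ?_⟩
  obtain ⟨N', hN'⟩ := exists_isCompl N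
  have hc : IsCompl N.toSubmodule N'.toSubmodule := by
    rw [isCompl_iff, disjoint_iff, codisjoint_iff] at hN' ⊢
    exact ⟨congrArg Subrepresentation.toSubmodule hN'.1,
      congrArg Subrepresentation.toSubmodule hN'.2⟩
  let P := N.toSubmodule.subtype ∘ₗ N.toSubmodule.projectionOnto N'.toSubmodule hc
  have hP : ∀ g w, P (specht lam g w) = specht lam g (P w) := by
    intro g w
    have hw := Submodule.mem_top (R := ℂ) (x := w)
    rw [← hc.sup_eq_top] at hw
    obtain ⟨a, ha, b, hb, rfl⟩ := Submodule.mem_sup.mp hw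
    have h1 : ∀ a ∈ N.toSubmodule, P a = a := fun a ha =>
      congrArg Subtype.val (Submodule.projectionOnto_apply_left hc ⟨a, ha⟩)
    have h2 : ∀ b ∈ N'.toSubmodule, P b = 0 := fun b hb =>
      congrArg Subtype.val ((Submodule.projectionOnto_apply_eq_zero_iff hc).mpr hb)
    rw [map_add, map_add, map_add, h1 a ha, h2 b hb, add_zero,
      h1 _ (N.apply_mem_toSubmodule g ha), h2 _ (N'.apply_mem_toSubmodule g hb), add_zero]
  obtain ⟨a, ha⟩ := hscalar
    (LinearMap.intertwiningMap_of_isIntertwiningMap (specht lam) (specht lam) P hP)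
  have ha' : ∀ w, P w = a • w := ha
  by_cases h0 : a = 0
  · left
    refine Subrepresentation.toSubmodule_injective (eq_bot_iff.mpr fun x hx => ?_)
    have h1 : P x = x :=
      congrArg Subtype.val (Submodule.projectionOnto_apply_left hc ⟨x, hx⟩)
    rw [ha', h0, zero_smul] at h1
    exact h1.symm
  · right
    refine Subrepresentation.toSubmodule_injective (eq_top_iff.mpr fun x _ => ?_)
    have h1 : x = a⁻¹ • P x := by rw [ha', inv_smul_smul₀ h0]
    rw [h1]
    exact N.toSubmodule.smul_mem _ (Subtype.property _)

end Kostka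

/-! ### The monomial basis of the symmetric power -/

section MonomialBasis

variable {n : ℕ}

/-- Exponent vectors of monomials of degree `k` in `n` variables. -/
abbrev Exponent (n k : ℕ) : Type := {m : Fin n → ℕ // ∑ i, m i = k}

/-- The exponent vector of the monomial `v_{f 1} ⋯ v_{f k}`. -/
noncomputable def content {k : ℕ} (f : Fin k → Fin n) : Exponent n k :=
  ⟨fun i => Nat.card {j // f j = i}, by
    rw [← Nat.card_sigma, Nat.card_congr (Equiv.sigmaFiberEquiv f), Nat.card_fin]⟩

theorem content_surjective (k : ℕ) : Function.Surjective (content (n := n) (k := k)) := by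
  rintro ⟨m, rfl⟩
  refine ⟨fun j => (finSigmaFinEquiv.symm j).1, Subtype.ext (funext fun i => ?_)⟩
  have h := Nat.card_congr (finSigmaFinEquiv.symm.subtypeEquiv
    (p := fun j => (finSigmaFinEquiv.symm j).1 = i) (q := fun s : Σ i, Fin (m i) => s.1 = i)
    fun j => Iff.rfl)
  exact h.trans ((Nat.card_congr (Equiv.sigmaSubtype i)).trans (Nat.card_fin _))

theorem exists_perm_of_content_eq {k : ℕ} {f g : Fin k → Fin n} (h : content f = content g) :
    ∃ τ : Equiv.Perm (Fin k), g ∘ τ = f := by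
  obtain ⟨e, he⟩ := exists_equiv_of_card_fiber f g fun i => congrFun (congrArg Subtype.val h) i
  exact ⟨e, funext he⟩

theorem content_comp_perm {k : ℕ} (f : Fin k → Fin n) (τ : Equiv.Perm (Fin k)) :
    content (f ∘ τ) = content f :=
  Subtype.ext (funext fun i =>
    Nat.card_congr (τ.subtypeEquiv (p := fun j => f (τ j) = i) fun _ => Iff.rfl))

theorem content_perm_comp {k : ℕ} (f : Fin k → Fin n) (σ : Equiv.Perm (Fin n)) (i : Fin n) :
    (content (σ ∘ f)).1 i = (content f).1 (σ⁻¹ i) :=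
  Nat.card_congr (Equiv.subtypeEquivRight fun _ => (Equiv.Perm.eq_inv_iff_eq).symm)

variable {V : Type*} [AddCommGroup V] [Module ℂ V] (v : Module.Basis (Fin n) ℂ V) (k : ℕ)

/-- The basis of the tensor power given by the pure tensors of basis vectors. -/
noncomputable def tensorBasis : Module.Basis (Fin k → Fin n) ℂ (⨂[ℂ] _ : Fin k, V) :=
  Basis.piTensorProduct fun _ => v

theorem tensorBasis_apply (f : Fin k → Fin n) :
    tensorBasis v k f = PiTensorProduct.tprod ℂ fun j => v (f j) :=
  Basis.piTensorProduct_apply _ _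

theorem symmetrizer_placePerm (τ : Equiv.Perm (Fin k)) (x : ⨂[ℂ] _ : Fin k, V) :
    symmetrizer V k (placePerm V τ x) = symmetrizer V k x := by
  have h : symmetrizer V k ∘ₗ placePerm V τ = symmetrizer V k := by
    ext x
    simp only [symmetrizer, LinearMap.smul_comp, LinearMap.compMultilinearMap_apply,
      LinearMap.smul_apply, LinearMap.comp_apply, LinearMap.sum_apply, placePerm_tprod]
    congr 1
    exact Equiv.sum_comp (Equiv.mulLeft τ) fun π : Equiv.Perm (Fin k) =>
      PiTensorProduct.tprod ℂ fun j => x (π j)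
  exact LinearMap.congr_fun h x

theorem symmetrizer_tensorBasis_congr {f g : Fin k → Fin n} (h : content f = content g) :
    symmetrizer V k (tensorBasis v k f) = symmetrizer V k (tensorBasis v k g) := by
  obtain ⟨τ, rfl⟩ := exists_perm_of_content_eq h
  rw [← symmetrizer_placePerm k τ (tensorBasis v k g), tensorBasis_apply, tensorBasis_apply,
    placePerm_tprod]
  rfl

/-- The linear map which sends a pure tensor of basis vectors to its exponent vector. -/
noncomputable def contentMap : (⨂[ℂ] _ : Fin k, V) →ₗ[ℂ] Exponent n k →₀ ℂ :=
  (tensorBasis v k).constr ℂ fun f => Finsupp.single (content f) 1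

theorem contentMap_tensorBasis (f : Fin k → Fin n) :
    contentMap v k (tensorBasis v k f) = Finsupp.single (content f) 1 :=
  Module.Basis.constr_basis ..

theorem contentMap_symmetrizer (x : ⨂[ℂ] _ : Fin k, V) :
    contentMap v k (symmetrizer V k x) = contentMap v k x := by
  have h : contentMap v k ∘ₗ symmetrizer V k = contentMap v k := by
    refine (tensorBasis v k).ext fun f => ?_
    have h1 : ∀ τ : Equiv.Perm (Fin k), contentMap v k (placePerm V τ (tensorBasis v k f)) =
        Finsupp.single (content f) (1 : ℂ) := by
      intro τ
      rw [tensorBasis_apply, placePerm_tprod, ← content_comp_perm f τ,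
        ← contentMap_tensorBasis v k (f ∘ τ),
        tensorBasis_apply]
      rfl
    simp only [symmetrizer, LinearMap.comp_apply, LinearMap.smul_apply, LinearMap.sum_apply,
      map_smul, map_sum, h1, contentMap_tensorBasis, Finset.sum_const, Finset.card_univ,
      Fintype.card_perm, Fintype.card_fin]
    rw [← Nat.cast_smul_eq_nsmul ℂ, inv_smul_smul₀ (Nat.cast_ne_zero.mpr k.factorial_ne_zero)]
  exact LinearMap.congr_fun h x

/-- The symmetrized tensor with a given exponent vector. -/
noncomputable def monomial (m : Exponent n k) : (symPowSub (natRep v) k).toSubmodule :=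
  ⟨symmetrizer V k (tensorBasis v k (Function.surjInv (content_surjective k) m)), ⟨_, rfl⟩⟩

theorem coe_monomial_content (f : Fin k → Fin n) :
    (monomial v k (content f) : ⨂[ℂ] _ : Fin k, V) = symmetrizer V k (tensorBasis v k f) :=
  symmetrizer_tensorBasis_congr v k (Function.surjInv_eq _ _)

/-- The monomials form a basis of the symmetric power. -/
noncomputable def monomialBasis :
    Module.Basis (Exponent n k) ℂ (symPowSub (natRep v) k).toSubmodule :=
  .ofRepr <| LinearEquiv.ofLinearMap
    (contentMap v k ∘ₗ (symPowSub (natRep v) k).toSubmodule.subtype)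
    (Finsupp.linearCombination ℂ (monomial v k))
    (by
      ext m : 2
      obtain ⟨f, rfl⟩ := content_surjective k m
      simp only [LinearMap.comp_apply, Finsupp.lsingle_apply, Finsupp.linearCombination_single,
        one_smul, Submodule.subtype_apply, LinearMap.id_apply]
      rw [coe_monomial_content, contentMap_symmetrizer, contentMap_tensorBasis])
    (by
      refine LinearMap.ext fun ⟨y, x, hx⟩ => Subtype.ext ?_
      subst hx
      simp only [LinearMap.comp_apply, Submodule.subtype_apply, LinearMap.id_apply]
      rw [contentMap_symmetrizer]
      have h : (symPowSub (natRep v) k).toSubmodule.subtype ∘ₗ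
          Finsupp.linearCombination ℂ (monomial v k) ∘ₗ contentMap v k = symmetrizer V k := by
        refine (tensorBasis v k).ext fun f => ?_
        simp only [LinearMap.comp_apply, contentMap_tensorBasis, Finsupp.linearCombination_single,
          one_smul, Submodule.subtype_apply, coe_monomial_content]
      exact LinearMap.congr_fun h x)

theorem monomialBasis_apply (m : Exponent n k) : monomialBasis v k m = monomial v k m := by
  refine (Finsupp.linearCombination_single ℂ (1 : ℂ) m).trans ?_
  exact one_smul ℂ _

/-- The action of the symmetric group on exponent vectors. -/
def permExponent {k : ℕ} (σ : Equiv.Perm (Fin n)) (m : Exponent n k) : Exponent n k :=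
  ⟨fun i => m.1 (σ⁻¹ i), (Equiv.sum_comp σ⁻¹ m.1).trans m.2⟩

theorem symPowRep_monomialBasis (σ : Equiv.Perm (Fin n)) (m : Exponent n k) :
    symPowRep v k σ (monomialBasis v k m) = monomialBasis v k (permExponent σ m) := by
  obtain ⟨f, rfl⟩ := content_surjective k m
  have h : permExponent σ (content f) = content (σ ∘ f) :=
    Subtype.ext (funext fun i => (content_perm_comp f σ i).symm)
  rw [h, monomialBasis_apply, monomialBasis_apply]
  refine Subtype.ext ?_
  rw [coe_monomial_content]
  change tensorPowRep (natRep v) k σ (monomial v k (content f) : ⨂[ℂ] _ : Fin k, V) = _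
  rw [coe_monomial_content, tensorPowRep_symmetrizer]
  congr 1
  rw [tensorBasis_apply, tensorBasis_apply]
  refine (PiTensorProduct.map_tprod _ _).trans ?_
  congr 1
  funext j
  simp [natRep]

end MonomialBasis

/-! ### Exponent vectors and tabloids -/

section ExponentTabloid

variable {n k : ℕ}

/-- The number of coordinates equal to `a` in an exponent vector whose nonzero coordinates are the
parts of `ν`. -/
def levelSize (ν : ParLE k n) (a : ℕ) : ℕ :=
  if a = 0 then n - ν.1.parts.card else ν.1.parts.count a

theorem count_map_eq_card {S : Multiset ℕ} (hS : S.Nodup) {p : ℕ → ℕ}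
    (hp : ∀ a, p a ≠ 0 → a ∈ S) {c : ℕ} (hc : c ≠ 0) :
    (S.map p).count c = Nat.card {a // p a = c} := by
  rw [Multiset.count_map, Nat.subtype_card ((⟨S, hS⟩ : Finset ℕ).filter fun a => c = p a)]
  · rfl
  · intro a
    rw [Finset.mem_filter]
    exact ⟨fun h => h.2.symm, fun h => ⟨hp a (h ▸ hc), h.symm⟩⟩

theorem card_getD_partList (mu : n.Partition) {c : ℕ} (hc : c ≠ 0) :
    Nat.card {i // (partList mu).getD i 0 = c} = mu.parts.count c := by
  have h : ((partList mu : List ℕ) : Multiset ℕ) =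
      (Multiset.range (partList mu).length).map fun i => (partList mu).getD i 0 := by
    rw [← Multiset.coe_range, Multiset.map_coe]
    congr 1
    refine List.ext_getElem (by simp) fun i h1 h2 => ?_
    rw [List.getElem_map, List.getElem_range, List.getD_eq_getElem _ _ h1]
  have h' : mu.parts =
      (Multiset.range (partList mu).length).map fun i => (partList mu).getD i 0 := by
    rw [← h, partList, Multiset.sort_eq]
  rw [h', count_map_eq_card (Multiset.nodup_range _) _ hc]
  intro i hi
  rw [Multiset.mem_range]
  by_contra! h1
  exact hi (List.getD_eq_default _ _ h1)

theorem card_levelSize (ν : ParLE k n) {c : ℕ} (hc : c ≠ 0) :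
    Nat.card {a // levelSize ν a = c} = (Phi ν).parts.count c := by
  have h0 : 0 ∉ ν.1.parts := fun h => (ν.1.parts_pos h).ne rfl
  have h : ((n - ν.1.parts.card) ::ₘ ν.1.parts.dedup.map fun a => ν.1.parts.count a) =
      (0 ::ₘ ν.1.parts.dedup).map (levelSize ν) := by
    rw [Multiset.map_cons]
    congr 1
    refine Multiset.map_congr rfl fun a ha => (if_neg ?_).symm
    rintro rfl
    exact h0 (Multiset.mem_dedup.mp ha)
  rw [Phi, Nat.Partition.ofSums_parts, Multiset.count_filter_of_pos (p := (· ≠ 0)) hc, h,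
    count_map_eq_card _ _ hc]
  · exact Multiset.nodup_cons.mpr ⟨fun h => h0 (Multiset.mem_dedup.mp h), Multiset.nodup_dedup _⟩
  · intro a ha
    rw [Multiset.mem_cons, Multiset.mem_dedup]
    by_cases ha0 : a = 0
    · exact Or.inl ha0
    · rw [levelSize, if_neg ha0] at ha
      exact Or.inr (Multiset.count_ne_zero.mp ha)

/-- The rows of the diagram of `Φ(ν)` correspond to the values taken by an exponent vector of
type `ν`, with the row lengths equal to the numbers of coordinates with these values. -/
theorem exists_relabelling (ν : ParLE k n) : ∃ d e : ℕ → ℕ,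
    (∀ i, (partList (Phi ν)).getD i 0 ≠ 0 →
      levelSize ν (d i) = (partList (Phi ν)).getD i 0 ∧ e (d i) = i) ∧
    ∀ a, levelSize ν a ≠ 0 → (partList (Phi ν)).getD (e a) 0 = levelSize ν a ∧ d (e a) = a := by
  classical
  have hf1 : Finite {i // (partList (Phi ν)).getD i 0 ≠ 0} := by
    refine Set.Finite.subset (Set.finite_Iio (partList (Phi ν)).length) fun i hi => ?_
    by_contra h1
    exact hi (List.getD_eq_default _ _ (not_lt.mp h1))
  have hf2 : Finite {a // levelSize ν a ≠ 0} := by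
    refine Set.Finite.subset (insert 0 ν.1.parts.toFinset : Finset ℕ).finite_toSet fun a ha => ?_
    rw [Finset.mem_coe, Finset.mem_insert, Multiset.mem_toFinset]
    by_cases ha0 : a = 0
    · exact Or.inl ha0
    · have ha : levelSize ν a ≠ 0 := ha
      rw [levelSize, if_neg ha0] at ha
      exact Or.inr (Multiset.count_ne_zero.mp ha)
  have hsub : ∀ (p : ℕ → ℕ) {c : ℕ}, c ≠ 0 →
      Nat.card {a : {a // p a ≠ 0} // p a = c} = Nat.card {a // p a = c} := fun p c hc =>
    Nat.card_congr (Equiv.subtypeSubtypeEquivSubtype fun {a} (h : p a = c) => h ▸ hc)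
  obtain ⟨E, hE⟩ := exists_equiv_of_card_fiber
    (fun i : {i // (partList (Phi ν)).getD i 0 ≠ 0} => (partList (Phi ν)).getD i 0)
    (fun a : {a // levelSize ν a ≠ 0} => levelSize ν a) (fun c => by
      rcases eq_or_ne c 0 with rfl | hc
      · rw [Nat.card_eq_zero.mpr (Or.inl ⟨fun i => i.1.2 i.2⟩),
          Nat.card_eq_zero.mpr (Or.inl ⟨fun i => i.1.2 i.2⟩)]
      · rw [hsub (fun i => (partList (Phi ν)).getD i 0) hc, hsub (levelSize ν) hc,
          card_getD_partList _ hc, card_levelSize ν hc])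
  refine ⟨fun i => if h : (partList (Phi ν)).getD i 0 ≠ 0 then (E ⟨i, h⟩).1 else 0,
    fun a => if h : levelSize ν a ≠ 0 then (E.symm ⟨a, h⟩).1 else 0, fun i hi => ?_, fun a ha => ?_⟩
  · simp only [dif_pos hi]
    rw [dif_pos (E ⟨i, hi⟩).2]
    refine ⟨hE ⟨i, hi⟩, ?_⟩
    rw [Subtype.coe_eta, Equiv.symm_apply_apply]
  · simp only [dif_pos ha]
    rw [dif_pos (E.symm ⟨a, ha⟩).2]
    refine ⟨?_, ?_⟩
    · rw [← hE, Equiv.apply_symm_apply]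
    · rw [Subtype.coe_eta, Equiv.apply_symm_apply]

/-- Relabelling the letters turns a word with letter multiplicities `g` into one with letter
multiplicities `s`. Letters of multiplicity zero do not occur, so `d` and `e` need only be inverse
to each other on the remaining ones. -/
theorem card_fiber_relabel {f : Fin n → ℕ} {g s d e : ℕ → ℕ}
    (hf : ∀ i, Nat.card {x // f x = i} = g i)
    (hd : ∀ i, g i ≠ 0 → s (d i) = g i ∧ e (d i) = i)
    (he : ∀ a, s a ≠ 0 → g (e a) = s a ∧ d (e a) = a) (a : ℕ) :
    Nat.card {x // d (f x) = a} = s a := by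
  have hne : ∀ x, g (f x) ≠ 0 := fun x => by
    rw [← hf, Nat.card_ne_zero]
    exact ⟨⟨x, rfl⟩, inferInstance⟩
  by_cases ha : s a = 0
  · rw [ha, Nat.card_eq_zero]
    refine Or.inl ⟨fun x => hne x.1 ?_⟩
    rw [← (hd _ (hne x.1)).1, x.2, ha]
  · rw [← (he a ha).1, ← hf]
    refine Nat.card_congr (Equiv.subtypeEquivRight fun x => ⟨fun h => ?_, fun h => ?_⟩)
    · rw [← (hd _ (hne x)).2, h]
    · rw [h, (he a ha).2]

theorem count_map_univ (m : Fin n → ℕ) (a : ℕ) :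
    (Finset.univ.val.map m).count a = Nat.card {x // m x = a} := by
  rw [Multiset.count_map, Nat.subtype_card (Finset.univ.filter fun x => a = m x)]
  · rfl
  · intro x
    simp [eq_comm]

theorem card_fiber_eq_levelSize_iff (ν : ParLE k n) (m : Fin n → ℕ) :
    (∀ a, Nat.card {x // m x = a} = levelSize ν a) ↔
      (Finset.univ.val.map m).filter (· ≠ 0) = ν.1.parts := by
  constructor
  · intro h
    refine Multiset.ext.mpr fun a => ?_
    rcases eq_or_ne a 0 with rfl | ha
    · rw [Multiset.count_eq_zero.mpr fun h => (ν.1.parts_pos h).ne rfl]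
      exact Multiset.count_eq_zero.mpr fun h => (Multiset.mem_filter.mp h).2 rfl
    · rw [Multiset.count_filter_of_pos (p := (· ≠ 0)) ha, count_map_univ, h, levelSize, if_neg ha]
  · intro h a
    rw [← count_map_univ, levelSize]
    split_ifs with ha
    · subst ha
      have h1 := congrArg Multiset.card (Multiset.filter_add_not (· ≠ 0) (Finset.univ.val.map m))
      rw [Multiset.card_add, h, Multiset.card_map, Finset.card_val, Finset.card_univ,
        Fintype.card_fin] at h1
      rw [Multiset.count_eq_card_filter_eq]
      have h2 : (Finset.univ.val.map m).filter (0 = ·) =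
          (Finset.univ.val.map m).filter fun a => ¬ a ≠ 0 :=
        Multiset.filter_congr fun a _ => eq_comm.trans not_not.symm
      rw [h2]
      omega
    · rw [← h, Multiset.count_filter_of_pos (p := (· ≠ 0)) ha]

/-- The partition of `k` formed by the nonzero coordinates of an exponent vector. -/
def exponentType (m : Exponent n k) : ParLE k n :=
  ⟨Nat.Partition.ofSums k (Finset.univ.val.map m.1) ((Finset.sum_map_val _ _).trans m.2), by
    rw [Nat.Partition.ofSums_parts]
    refine (Multiset.card_le_card (Multiset.filter_le _ _)).trans ?_
    simp⟩

theorem exponentType_eq_iff (ν : ParLE k n) (m : Exponent n k) :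
    exponentType m = ν ↔ ∀ a, Nat.card {x // m.1 x = a} = levelSize ν a := by
  rw [card_fiber_eq_levelSize_iff, Subtype.ext_iff, Nat.Partition.ext_iff]
  rfl

/-- The exponent vectors of degree `k` are, compatibly with the symmetric group, the tabloids of the
shapes `Φ(ν)`. -/
theorem exists_sigma_tabloid_equiv (n k : ℕ) :
    ∃ F : (Σ ν : ParLE k n, Tabloid (Phi ν)) ≃ Exponent n k,
      ∀ (σ : Equiv.Perm (Fin n)) (ν : ParLE k n) (X : Tabloid (Phi ν)),
        F ⟨ν, σ • X⟩ = permExponent σ (F ⟨ν, X⟩) := by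
  choose d e hd he using fun ν : ParLE k n => exists_relabelling ν
  have hlevel : ∀ (ν : ParLE k n) (X : Tabloid (Phi ν)) (a : ℕ),
      Nat.card {x // d ν (rowWord X x) = a} = levelSize ν a := fun ν X =>
    card_fiber_relabel (card_rowWord X) (hd ν) (he ν)
  let F : (Σ ν : ParLE k n, Tabloid (Phi ν)) → Exponent n k := fun p =>
    ⟨fun x => d p.1 (rowWord p.2 x), by
      have h := (card_fiber_eq_levelSize_iff p.1 _).mp (hlevel p.1 p.2)
      have h0 : ((Finset.univ.val.map fun x => d p.1 (rowWord p.2 x)).filter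
          fun a => ¬ a ≠ 0).sum = 0 := by
        rw [Multiset.sum_eq_zero_iff]
        intro a ha
        simpa using (Multiset.mem_filter.mp ha).2
      have h1 := congrArg Multiset.sum (Multiset.filter_add_not (· ≠ 0)
        (Finset.univ.val.map fun x => d p.1 (rowWord p.2 x)))
      rw [Multiset.sum_add, h0, h, p.1.1.parts_sum, add_zero] at h1
      exact h1.symm⟩
  have htype : ∀ p, exponentType (F p) = p.1 := fun p =>
    (exponentType_eq_iff p.1 (F p)).mpr (hlevel p.1 p.2)
  have hF : Function.Bijective F := by
    constructor
    · rintro ⟨ν, X⟩ ⟨ν', X'⟩ h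
      obtain rfl : ν = ν' := (htype ⟨ν, X⟩).symm.trans ((congrArg _ h).trans (htype ⟨ν', X'⟩))
      congr 1
      refine rowWord_injective (funext fun x => ?_)
      have hx : d ν (rowWord X x) = d ν (rowWord X' x) := congrFun (congrArg Subtype.val h) x
      have hne : ∀ Y : Tabloid (Phi ν), (partList (Phi ν)).getD (rowWord Y x) 0 ≠ 0 := fun Y => by
        rw [← card_rowWord Y, Nat.card_ne_zero]
        exact ⟨⟨x, rfl⟩, inferInstance⟩
      rw [← (hd ν _ (hne X)).2, hx, (hd ν _ (hne X')).2]
    · intro m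
      have hm := (exponentType_eq_iff (exponentType m) m).mp rfl
      obtain ⟨X, hX⟩ := exists_rowWord_eq
        (card_fiber_relabel hm (he (exponentType m)) (hd (exponentType m)))
      refine ⟨⟨exponentType m, X⟩, Subtype.ext (funext fun x => ?_)⟩
      change d (exponentType m) (rowWord X x) = m.1 x
      rw [hX]
      refine (he _ _ ?_).2
      rw [← hm, Nat.card_ne_zero]
      exact ⟨⟨x, rfl⟩, inferInstance⟩
  refine ⟨Equiv.ofBijective F hF, fun σ ν X => Subtype.ext (funext fun x => ?_)⟩
  exact congrArg (d ν) (rowWord_smul σ X x)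

end ExponentTabloid

/-! ### The decomposition of the symmetric power -/

section Decomposition

variable {n : ℕ} {V : Type*} [AddCommGroup V] [Module ℂ V]

/-- The tabloids form a basis of the permutation module. -/
noncomputable def tabloidBasis (mu : n.Partition) :
    Module.Basis (Tabloid mu) ℂ (MonoidAlgebra ℂ (Tabloid mu)) :=
  .ofRepr (MonoidAlgebra.coeffLinearEquiv ℂ)

theorem tabloidBasis_apply (mu : n.Partition) (X : Tabloid mu) :
    tabloidBasis mu X = MonoidAlgebra.single X 1 := rfl

theorem dfinsupp_basis_apply {ι : Type*} [DecidableEq ι] {η : ι → Type*} {M : ι → Type*}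
    [∀ i, AddCommGroup (M i)] [∀ i, Module ℂ (M i)] (b : ∀ i, Module.Basis (η i) ℂ (M i)) (i : ι)
    (j : η i) : DFinsupp.basis b ⟨i, j⟩ = DFinsupp.single i (b i j) := by
  classical
  refine (DFinsupp.basis b).repr.injective ?_
  rw [Module.Basis.repr_self]
  change _ = (sigmaFinsuppLequivDFinsupp ℂ).symm
    (DFinsupp.mapRange.linearEquiv (fun i => (b i).repr) (DFinsupp.single i (b i j)))
  rw [LinearEquiv.eq_symm_apply]
  refine (sigmaFinsuppEquivDFinsupp_single _ _).trans ?_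
  refine Eq.symm ((DFinsupp.mapRange_single (hf := fun i => map_zero (b i).repr)).trans ?_)
  exact congrArg _ ((b i).repr_self j)

theorem nonempty_symPowRep_equiv (v : Module.Basis (Fin n) ℂ V) (k : ℕ) :
    Nonempty ((symPowRep v k).Equiv
      (Representation.directSum fun ν : ParLE k n => permModule (Phi ν))) := by
  classical
  obtain ⟨F, hF⟩ := exists_sigma_tabloid_equiv n k
  refine nonempty_equiv_of_basis ((monomialBasis v k).reindex F.symm)
    (DFinsupp.basis fun ν : ParLE k n => tabloidBasis (Phi ν)) (fun σ p => ⟨p.1, σ • p.2⟩) ?_ ?_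
  · rintro σ ⟨ν, X⟩
    rw [Module.Basis.reindex_apply, Module.Basis.reindex_apply, Equiv.symm_symm,
      symPowRep_monomialBasis, hF]
  · rintro σ ⟨ν, X⟩
    rw [dfinsupp_basis_apply, dfinsupp_basis_apply, tabloidBasis_apply, tabloidBasis_apply,
      ← permModule_single]
    exact DirectSum.lmap_lof (fun ν : ParLE k n => permModule (Phi ν) σ) ν _

end Decomposition

end SymPow

theorem theorem6p1 (n k : ℕ) {V : Type*} [AddCommGroup V] [Module ℂ V]
    (v : Module.Basis (Fin n) ℂ V) :
    Nonempty ((SymPow.symPowRep v k).Equiv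
      (Representation.directSum fun ν : SymPow.ParLE k n => SymPow.permModule (SymPow.Phi ν))) ∧
    ∀ lam : n.Partition, SymPow.HasMultiplicity (SymPow.symPowRep v k) (SymPow.specht lam)
      (∑ ν : SymPow.ParLE k n, SymPow.kostka lam (SymPow.Phi ν)) := by
  obtain ⟨e⟩ := SymPow.nonempty_symPowRep_equiv v k
  refine ⟨⟨e⟩, fun lam => ?_⟩
  have hV : FiniteDimensional ℂ V := Module.Finite.of_basis v
  have hirr := SymPow.isIrreducible_specht lam
  have h := SymPow.hasMultiplicity_finrank (SymPow.symPowRep v k) (SymPow.specht lam)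
  rw [(SymPow.homCongr _ e).finrank_eq, SymPow.finrank_hom_directSum] at h
  simpa only [SymPow.finrank_hom_specht_permModule] using h
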